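/- Let $B>0$, write $\mathbf x=(x,y,z)\in\mathbb R^3$ and $r_\perp=\sqrt{x^2+y^2}$. In $L^2(\mathbb R^3;\mathbb C)$ let $L_z$ and $H_B$ be the self-adjoint operators given by the closures of $$-i\left(x\frac{\partial}{\partial y}-y\frac{\partial}{\partial x}\right)\qquad\text{and}\qquad -\Delta-B\,L_z+\frac{B^2}{4}r_\perp^2,$$ respectively, on $C_0^\infty(\mathbb R^3)$. Let $V:\mathbb R^3\to\mathbb R$ be locally $L^2$. Suppose that there are constants $R>0$ and $M$ such that for all $n\in\mathbb Z$ $$\int_n^{n+1}dz\int_{r_\perp<R}dx\,dy\,|V(\mathbf x)|^2\le M^2 ,$$ and that there are constants $C$ and $C_V<B^2/4$ such that $$|V(\mathbf x)|\le C+C_V\,r_\perp^2\qquad\text{for almost all }\mathbf x\text{ with } r_\perp>R .$$ Then for every $m\in\mathbb Z$ there are constants $0\le b_1<1$ and $b_2\ge 0$ (depending on $m$) such that every $\psi$ in the domain of $H_B$ with $L_z\psi=m\psi$ (that is, $\psi$ in the domain of $L_z$ and an element of its eigenspace for $m$) satisfies $V\psi\in L^2(\mathbb R^3)$ and $$\|V\psi\|\le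 b_1\|H_B\psi\|+b_2\|\psi\| .$$ -/

import Mathlib

open MeasureTheory
open scoped ContDiff ENNReal

noncomputable section

/-- Configuration space `ℝ³`, with coordinates `x 0`, `x 1`, `x 2` standing for `x`, `y`, `z`. -/
abbrev Space3 : Type := EuclideanSpace ℝ (Fin 3)

/-- The Hilbert space `L²(ℝ³, d³x)` of complex-valued functions. -/
abbrev L2Space : Type := Lp ℂ 2 (volume : Measure Space3)

/-- The distance `r_⊥ = √(x² + y²)` to the `z`-axis. -/
def rPerp (x : Space3) : ℝ := Real.sqrt (x 0 ^ 2 + x 1 ^ 2)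

/-- The space `C₀^∞(ℝ³)` of smooth complex functions with compact support. -/
def testFun : Submodule ℂ (Space3 → ℂ) where
  carrier := {f | ContDiff ℝ ∞ f ∧ HasCompactSupport f}
  zero_mem' := ⟨contDiff_const, HasCompactSupport.zero⟩
  add_mem' hf hg := ⟨hf.1.add hg.1, hf.2.add hg.2⟩
  smul_mem' c _ hf := ⟨hf.1.const_smul c, hf.2.smul_left (f := fun _ => c)⟩

namespace testFun

theorem contDiff (f : testFun) : ContDiff ℝ ∞ (f : Space3 → ℂ) := f.2.1

theorem hasCompactSupport (f : testFun) : HasCompactSupport (f : Space3 → ℂ) := f.2.2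

theorem memLp (f : testFun) : MemLp (f : Space3 → ℂ) 2 (volume : Measure Space3) :=
  (contDiff f).continuous.memLp_of_hasCompactSupport (hasCompactSupport f)

/-- The partial derivative `∂ / ∂ xᵢ` on `C₀^∞(ℝ³)`. -/
def partialD (i : Fin 3) : Module.End ℂ testFun where
  toFun f := ⟨fun x => fderiv ℝ (f : Space3 → ℂ) x (EuclideanSpace.single i 1),
    ((contDiff f).fderiv_right (m := ∞) (by simp)).clm_apply contDiff_const,
    (hasCompactSupport f).fderiv_apply (𝕜 := ℝ) _⟩
  map_add' f g := by
    ext x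
    have hf := ((contDiff f).differentiable (by simp)) x
    have hg := ((contDiff g).differentiable (by simp)) x
    simp [fderiv_add hf hg]
  map_smul' c f := by
    ext x
    have hf := ((contDiff f).differentiable (by simp)) x
    simp [fderiv_const_smul hf c]

/-- Multiplication by the coordinate `xᵢ` on `C₀^∞(ℝ³)`. -/
def coordMul (i : Fin 3) : Module.End ℂ testFun where
  toFun f := ⟨fun x => ((x i : ℝ) : ℂ) * (f : Space3 → ℂ) x,
    (Complex.ofRealCLM.contDiff.comp (EuclideanSpace.proj (𝕜 := ℝ) i).contDiff).mul (contDiff f),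
    (hasCompactSupport f).mul_left (f := fun x : Space3 => ((x i : ℝ) : ℂ))⟩
  map_add' f g := by
    ext x
    simp [mul_add]
  map_smul' c f := by
    ext x
    simp [mul_left_comm]

/-- The inclusion `C₀^∞(ℝ³) → L²(ℝ³)`. -/
def toL2 : testFun →ₗ[ℂ] L2Space where
  toFun f := (memLp f).toLp (f : Space3 → ℂ)
  map_add' f g := MemLp.toLp_add (memLp f) (memLp g)
  map_smul' c f := MemLp.toLp_const_smul c (memLp f)

theorem toL2_injective : Function.Injective toL2 := by
  intro f g h
  have h' : (f : Space3 → ℂ) =ᵐ[volume] (g : Space3 → ℂ) :=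
    (MemLp.toLp_eq_toLp_iff (memLp f) (memLp g)).1 h
  exact Subtype.ext
    (((contDiff f).continuous.ae_eq_iff_eq volume (contDiff g).continuous).1 h')

/-- An operator on `C₀^∞(ℝ³)`, regarded as an unbounded operator in `L²(ℝ³)` with domain
`C₀^∞(ℝ³)`. -/
def toPMap (T : Module.End ℂ testFun) : L2Space →ₗ.[ℂ] L2Space where
  domain := LinearMap.range toL2
  toFun := toL2 ∘ₗ T ∘ₗ (LinearEquiv.ofInjective toL2 toL2_injective).symm.toLinearMap

/-- The differential expression `L_z = -i (x ∂_y - y ∂_x)` on `C₀^∞(ℝ³)`. -/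
def angMom : Module.End ℂ testFun :=
  (-Complex.I) • (coordMul 0 * partialD 1 - coordMul 1 * partialD 0)

/-- The Laplacian `Δ` on `C₀^∞(ℝ³)`. -/
def lapl : Module.End ℂ testFun := ∑ i : Fin 3, partialD i * partialD i

/-- The differential expression `-Δ - B L_z + (B² / 4) r_⊥²` on `C₀^∞(ℝ³)`. -/
def magnetic (B : ℝ) : Module.End ℂ testFun :=
  -lapl - (B : ℂ) • angMom + ((B ^ 2 / 4 : ℝ) : ℂ) • (coordMul 0 ^ 2 + coordMul 1 ^ 2)

end testFun

/-- The self-adjoint operator `L_z` in `L²(ℝ³)`: the closure of `-i (x ∂_y - y ∂_x)` on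
`C₀^∞(ℝ³)`, where it is essentially self-adjoint. -/
def angularMomentum : L2Space →ₗ.[ℂ] L2Space := (testFun.toPMap testFun.angMom).closure

/-- The self-adjoint operator `H_B = -Δ - B L_z + (B² / 4) r_⊥²` in `L²(ℝ³)`: the closure of
this expression on `C₀^∞(ℝ³)`, where it is essentially self-adjoint. -/
def magneticHamiltonian (B : ℝ) : L2Space →ₗ.[ℂ] L2Space :=
  (testFun.toPMap (testFun.magnetic B)).closure

/-- The angular momentum sector: all `ψ` in the domain of `L_z` with `L_z ψ = m ψ`. -/
def angularSector (m : ℤ) : Submodule ℂ L2Space where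
  carrier := {ψ | ∃ h : ψ ∈ angularMomentum.domain, angularMomentum ⟨ψ, h⟩ = (m : ℂ) • ψ}
  zero_mem' := ⟨Submodule.zero_mem _, by
    rw [smul_zero]; exact angularMomentum.map_zero⟩
  add_mem' := by
    rintro a b ⟨ha, ea⟩ ⟨hb, eb⟩
    refine ⟨Submodule.add_mem _ ha hb, ?_⟩
    rw [smul_add, ← ea, ← eb]
    exact angularMomentum.map_add ⟨a, ha⟩ ⟨b, hb⟩
  smul_mem' := by
    rintro c a ⟨ha, ea⟩
    refine ⟨Submodule.smul_mem _ c ha, ?_⟩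
    rw [smul_comm, ← ea]
    exact angularMomentum.map_smul c ⟨a, ha⟩

/-- The domain `{ψ ∈ L² : V ψ ∈ L²}` of the operator of multiplication by `V`. -/
def mulDomain (V : Space3 → ℝ) : Submodule ℂ L2Space where
  carrier := {ψ | MemLp (fun x => (V x : ℂ) * ψ x) 2 (volume : Measure Space3)}
  zero_mem' := by
    refine (memLp_congr_ae ?_).2 (MemLp.zero (ε := ℂ))
    filter_upwards [Lp.coeFn_zero ℂ 2 (volume : Measure Space3)] with x hx
    exact (congrArg ((V x : ℂ) * ·) hx).trans (mul_zero _)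
  add_mem' := by
    intro a b ha hb
    refine (memLp_congr_ae ?_).2 (MemLp.add ha hb)
    filter_upwards [Lp.coeFn_add a b] with x hx
    rw [hx, Pi.add_apply, mul_add, Pi.add_apply]
  smul_mem' := by
    intro c a ha
    refine (memLp_congr_ae ?_).2 (MemLp.const_smul ha c)
    filter_upwards [Lp.coeFn_smul c a] with x hx
    rw [hx, Pi.smul_apply, Pi.smul_apply, mul_smul_comm]

/-- The maximal operator of multiplication by `V` in `L²(ℝ³)`. -/
def mulOp (V : Space3 → ℝ) : L2Space →ₗ.[ℂ] L2Space where
  domain := mulDomain V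
  toFun :=
    { toFun := fun ψ => MemLp.toLp (fun x => (V x : ℂ) * (ψ : L2Space) x) ψ.2
      map_add' := by
        rintro ⟨a, ha⟩ ⟨b, hb⟩
        refine Eq.trans ?_ (MemLp.toLp_add ha hb)
        refine (MemLp.toLp_eq_toLp_iff _ _).2 ?_
        filter_upwards [Lp.coeFn_add a b] with x hx
        change (V x : ℂ) * (a + b : L2Space) x = _
        rw [hx, Pi.add_apply, mul_add, Pi.add_apply]
      map_smul' := by
        rintro c ⟨a, ha⟩
        refine Eq.trans ?_ (MemLp.toLp_const_smul c ha)
        refine (MemLp.toLp_eq_toLp_iff _ _).2 ?_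
        filter_upwards [Lp.coeFn_smul c a] with x hx
        change (V x : ℂ) * (c • a : L2Space) x = _
        rw [hx, Pi.smul_apply, Pi.smul_apply, mul_smul_comm] }

/-- On the subspace `S`, the operator `T` is bounded relative to `A` with constants `b₁`, `b₂`:
every `ψ ∈ D(A) ∩ S` lies in `D(T)` and satisfies `‖T ψ‖ ≤ b₁ ‖A ψ‖ + b₂ ‖ψ‖`. -/
def RelBoundedOn (S : Submodule ℂ L2Space) (A T : L2Space →ₗ.[ℂ] L2Space) (b₁ b₂ : ℝ) : Prop :=
  ∀ ψ : A.domain, (ψ : L2Space) ∈ S →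
    ∃ h : (ψ : L2Space) ∈ T.domain, ‖T ⟨ψ, h⟩‖ ≤ b₁ * ‖A ψ‖ + b₂ * ‖(ψ : L2Space)‖

end

noncomputable section

namespace testFun

open scoped ComplexInnerProductSpace

/-! ### Algebra of the operators on test functions -/

/-! On the sector `L_z = m` the operator `H_B` is the oscillator `-Δ + w r_⊥²`, `w = B²/4`, shifted
by the constant `-B m`. It therefore suffices to bound `V` relative to the oscillator with bound
below `1`; the shift only enlarges `b₂`.

For test functions, expanding the square of the oscillator and using `Re ⟨Δf, r_⊥² f⟩ ≤ 2‖f‖²` shows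
that `‖Δf‖` and `w‖r_⊥² f‖` are each at most `‖(-Δ + w r_⊥²) f‖ + 2√w ‖f‖` (`oscillator_energy`).
Outside the cylinder the growth condition costs the factor `max C_V 0 / w < 1`. Inside, `V` is
infinitesimally small relative to `Δ`: the three-dimensional Sobolev bound `|f(x)|² ≤ ε‖Δf‖² +
K‖f‖²`, applied to `f` cut off around one slab, is multiplied by the uniform `L²` bound of `V` there
and summed over slabs, which overlap boundedly after cutting off
(`exists_setLIntegral_cylinder_le`). The two regions together give `exists_oscillator_bound`.

The test functions approximating `ψ` in the graph norm of `H_B` need not lie in the sector, and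
`L_z` is not controlled along them. They are averaged over the rotations by multiples of `2π/N`,
twisted by `exp(-imθ)`. Averaging is a contraction, commutes with `H_B`, moves nothing away from
`ψ`, and makes `L_z - m` tend to zero as `N → ∞` (`tendsto_avg_twistGen`). So `ψ` is an `L²` limit
of test functions with controlled oscillator norm (`exists_seq_of_mem_sector`), and Fatou's lemma
carries the bound over to `ψ`. -/

theorem partialD_apply (i : Fin 3) (f : testFun) (x : Space3) :
    (partialD i f : Space3 → ℂ) x =
      fderiv ℝ (f : Space3 → ℂ) x (EuclideanSpace.single i 1) := rfl

theorem coordMul_apply (i : Fin 3) (f : testFun) (x : Space3) :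
    (coordMul i f : Space3 → ℂ) x = ((x i : ℝ) : ℂ) * (f : Space3 → ℂ) x := rfl

theorem differentiable (f : testFun) : Differentiable ℝ (f : Space3 → ℂ) :=
  (contDiff f).differentiable (by simp)

theorem coeFn_toL2 (f : testFun) : (toL2 f : Space3 → ℂ) =ᵐ[volume] (f : Space3 → ℂ) :=
  (memLp f).coeFn_toLp

theorem inner_toL2 (f g : testFun) :
    ⟪toL2 f, toL2 g⟫ = ∫ x, (starRingEnd ℂ) ((f : Space3 → ℂ) x) * (g : Space3 → ℂ) x := by
  rw [L2.inner_def]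
  refine integral_congr_ae ?_
  filter_upwards [coeFn_toL2 f, coeFn_toL2 g] with x hf hg
  rw [hf, hg, RCLike.inner_apply, mul_comm]

theorem enorm_toL2_sq (f : testFun) :
    ‖toL2 f‖ₑ ^ 2 = ∫⁻ x, ‖(f : Space3 → ℂ) x‖ₑ ^ 2 := by
  have h : ‖toL2 f‖ₑ = eLpNorm (f : Space3 → ℂ) 2 volume := Lp.enorm_toLp (memLp f)
  rw [h, eLpNorm_eq_lintegral_rpow_enorm_toReal (by simp) (by simp), ← ENNReal.rpow_natCast,
    ← ENNReal.rpow_mul]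
  simp

/-- Pointwise complex conjugation of test functions. -/
def conj (f : testFun) : testFun :=
  ⟨fun x => (starRingEnd ℂ) ((f : Space3 → ℂ) x),
    Complex.conjCLE.contDiff.comp (contDiff f),
    (hasCompactSupport f).comp_left (g := starRingEnd ℂ) (map_zero _)⟩

theorem conj_apply (f : testFun) (x : Space3) :
    (conj f : Space3 → ℂ) x = (starRingEnd ℂ) ((f : Space3 → ℂ) x) := rfl

theorem partialD_conj (i : Fin 3) (f : testFun) : partialD i (conj f) = conj (partialD i f) := by
  ext x
  have h := (Complex.conjCLE.toContinuousLinearMap.hasFDerivAt).comp x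
    (differentiable f x).hasFDerivAt
  exact congrArg (fun L => L (EuclideanSpace.single i 1)) h.fderiv

theorem integrable_mul (f g : testFun) :
    Integrable (fun x => (f : Space3 → ℂ) x * (g : Space3 → ℂ) x) :=
  (((contDiff f).continuous).mul ((contDiff g).continuous)).integrable_of_hasCompactSupport
    ((hasCompactSupport f).mul_right)

theorem inner_partialD_left (i : Fin 3) (f g : testFun) :
    ⟪toL2 (partialD i f), toL2 g⟫ = -⟪toL2 f, toL2 (partialD i g)⟫ := by
  rw [inner_toL2, inner_toL2, ← neg_eq_iff_eq_neg]
  have h := integral_mul_fderiv_eq_neg_fderiv_mul_of_integrable (μ := (volume : Measure Space3))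
    (f := (conj f : Space3 → ℂ)) (g := (g : Space3 → ℂ)) (v := EuclideanSpace.single i 1)
    (integrable_mul (partialD i (conj f)) g) (integrable_mul (conj f) (partialD i g))
    (integrable_mul (conj f) g) (fun x _ => differentiable _ x) (fun x _ => differentiable _ x)
  refine Eq.trans ?_ h.symm
  refine congrArg Neg.neg (integral_congr_ae (.of_forall fun x => ?_))
  change _ = (partialD i (conj f) : Space3 → ℂ) x * _
  rw [partialD_conj, conj_apply]

theorem inner_coordMul_left (i : Fin 3) (f g : testFun) :
    ⟪toL2 (coordMul i f), toL2 g⟫ = ⟪toL2 f, toL2 (coordMul i g)⟫ := by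
  rw [inner_toL2, inner_toL2]
  refine integral_congr_ae (.of_forall fun x => ?_)
  simp only [coordMul_apply, map_mul, Complex.conj_ofReal]
  ring

theorem partialD_coordMul (i j : Fin 3) (f : testFun) :
    partialD i (coordMul j f) = coordMul j (partialD i f) + (if i = j then (1 : ℂ) else 0) • f := by
  ext x
  have h1 : HasFDerivAt (fun y : Space3 => ((y j : ℝ) : ℂ))
      (Complex.ofRealCLM.comp (EuclideanSpace.proj (𝕜 := ℝ) j)) x :=
    (Complex.ofRealCLM.comp (EuclideanSpace.proj (𝕜 := ℝ) j)).hasFDerivAt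
  have h := (h1.mul (differentiable f x).hasFDerivAt).fderiv
  have h' := congrArg (fun L => L (EuclideanSpace.single i 1)) h
  refine Eq.trans (b := _) h' ?_
  by_cases hij : i = j
  · subst hij
    simp [coordMul_apply, partialD_apply]
  · simp [coordMul_apply, partialD_apply, hij, Ne.symm hij]

/-! ### The energy inequality -/

/-- Integration by parts and `[∂ᵢ, xᵢ] = 1` turn the inner product into minus its own conjugate
minus `‖f‖²`. -/
theorem re_inner_partialD_coordMul (i : Fin 3) (f : testFun) :
    2 * (⟪toL2 (partialD i f), toL2 (coordMul i f)⟫).re = -‖toL2 f‖ ^ 2 := by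
  have h : ⟪toL2 (partialD i f), toL2 (coordMul i f)⟫ =
      -(starRingEnd ℂ) ⟪toL2 (partialD i f), toL2 (coordMul i f)⟫ - ⟪toL2 f, toL2 f⟫ := by
    rw [inner_conj_symm, inner_partialD_left, partialD_coordMul, if_pos rfl, one_smul, map_add,
      inner_add_right, inner_coordMul_left]
    ring
  have h2 := congrArg Complex.re h
  rw [inner_self_eq_norm_sq_to_K] at h2
  simp only [Complex.sub_re, Complex.neg_re, Complex.conj_re] at h2
  have h3 : (((‖toL2 f‖ : ℂ)) ^ 2).re = ‖toL2 f‖ ^ 2 := by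
    rw [← Complex.ofReal_pow, Complex.ofReal_re]
  simp only [Complex.coe_algebraMap] at h2
  rw [h3] at h2
  linarith

/-- Moving one derivative across leaves `-‖xⱼ ∂ᵢ f‖²`, which is discarded, and for `i = j` the
commutator term `-2 Re ⟨∂ᵢ f, xᵢ f⟩ = ‖f‖²`. -/
theorem re_inner_partialD_sq_coordMul_sq (i j : Fin 3) (f : testFun) :
    (⟪toL2 (partialD i (partialD i f)), toL2 (coordMul j (coordMul j f))⟫).re ≤
      if i = j then ‖toL2 f‖ ^ 2 else 0 := by
  rw [inner_partialD_left, partialD_coordMul, partialD_coordMul]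
  by_cases h : i = j
  · subst h
    have h1 := re_inner_partialD_coordMul i f
    have h2 : ⟪toL2 (partialD i f), toL2 (coordMul i (coordMul i (partialD i f)))⟫ =
        ((‖toL2 (coordMul i (partialD i f))‖ ^ 2 : ℝ) : ℂ) := by
      rw [← inner_coordMul_left, inner_self_eq_norm_sq_to_K]
      simp
    simp only [if_true, one_smul, map_add, inner_add_right, h2, Complex.neg_re, Complex.add_re,
      Complex.ofReal_re]
    nlinarith [sq_nonneg ‖toL2 (coordMul i (partialD i f))‖]
  · have h2 : ⟪toL2 (partialD i f), toL2 (coordMul j (coordMul j (partialD i f)))⟫ =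
        ((‖toL2 (coordMul j (partialD i f))‖ ^ 2 : ℝ) : ℂ) := by
      rw [← inner_coordMul_left, inner_self_eq_norm_sq_to_K]
      simp
    simp only [if_neg h, zero_smul, add_zero, h2, Complex.neg_re, Complex.ofReal_re]
    nlinarith [sq_nonneg ‖toL2 (coordMul j (partialD i f))‖]

/-- Multiplication by `r_⊥²` on `C₀^∞(ℝ³)`. -/
def perpSq : Module.End ℂ testFun := coordMul 0 ^ 2 + coordMul 1 ^ 2

theorem perpSq_eq (f : testFun) :
    perpSq f = coordMul 0 (coordMul 0 f) + coordMul 1 (coordMul 1 f) := by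
  simp [perpSq, pow_two]

theorem perpSq_apply (f : testFun) (x : Space3) :
    (perpSq f : Space3 → ℂ) x = ((rPerp x ^ 2 : ℝ) : ℂ) * (f : Space3 → ℂ) x := by
  rw [perpSq_eq, rPerp, Real.sq_sqrt (by positivity)]
  simp only [Submodule.coe_add, Pi.add_apply, coordMul_apply]
  push_cast
  ring

theorem lapl_eq (f : testFun) : lapl f = partialD 0 (partialD 0 f) + partialD 1 (partialD 1 f) +
    partialD 2 (partialD 2 f) := by
  simp [lapl, Fin.sum_univ_three]

/-- Of the six products of a `∂ᵢ²` with an `xⱼ²`, only `i = j = 0` and `i = j = 1` may contribute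
positively, hence the `2`. -/
theorem re_inner_lapl_perpSq (f : testFun) :
    (⟪toL2 (lapl f), toL2 (perpSq f)⟫).re ≤ 2 * ‖toL2 f‖ ^ 2 := by
  have h := re_inner_partialD_sq_coordMul_sq
  rw [lapl_eq, perpSq_eq]
  simp only [map_add, inner_add_left, inner_add_right, Complex.add_re]
  have h00 := h 0 0 f
  have h01 := h 0 1 f
  have h10 := h 1 0 f
  have h11 := h 1 1 f
  have h20 := h 2 0 f
  have h21 := h 2 1 f
  simp only [Fin.isValue, if_true, zero_ne_one, one_ne_zero, if_false,
    show (2 : Fin 3) ≠ 0 by decide, show (2 : Fin 3) ≠ 1 by decide] at h00 h01 h10 h11 h20 h21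
  linarith

/-- The harmonic oscillator expression `-Δ + w r_⊥²`. -/
def oscillator (w : ℝ) : Module.End ℂ testFun := -lapl + (w : ℂ) • perpSq

theorem oscillator_energy {w : ℝ} (hw : 0 ≤ w) (f : testFun) :
    ‖toL2 (lapl f)‖ ^ 2 + (w * ‖toL2 (perpSq f)‖) ^ 2 ≤
      ‖toL2 (oscillator w f)‖ ^ 2 + 4 * w * ‖toL2 f‖ ^ 2 := by
  have h1 : toL2 (oscillator w f) = (w : ℂ) • toL2 (perpSq f) - toL2 (lapl f) := by
    simp [oscillator]
    abel
  have h2 := re_inner_lapl_perpSq f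
  have h3 : (⟪(w : ℂ) • toL2 (perpSq f), toL2 (lapl f)⟫).re =
      w * (⟪toL2 (lapl f), toL2 (perpSq f)⟫).re := by
    rw [inner_smul_left, Complex.conj_ofReal, Complex.re_ofReal_mul, ← inner_conj_symm,
      Complex.conj_re]
  rw [h1, @norm_sub_sq ℂ, RCLike.re_eq_complex_re, h3, norm_smul, Complex.norm_real,
    Real.norm_of_nonneg hw]
  nlinarith [mul_le_mul_of_nonneg_left h2 hw]

/-- Cauchy–Schwarz for `⟨-Δf, f⟩ = ∑ ‖∂ᵢ f‖²`. It controls the first-order term that appears when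
`Δ` acts on a function multiplied by a cutoff. -/
theorem norm_partialD_sq_le (i : Fin 3) (f : testFun) :
    ‖toL2 (partialD i f)‖ ^ 2 ≤ ‖toL2 (lapl f)‖ * ‖toL2 f‖ := by
  have key : ∀ j, (⟪toL2 (partialD j (partialD j f)), toL2 f⟫).re = -‖toL2 (partialD j f)‖ ^ 2 := by
    intro j
    rw [inner_partialD_left, inner_self_eq_norm_sq_to_K]
    simp [← Complex.ofReal_pow]
  have h : -(⟪toL2 (lapl f), toL2 f⟫).re =
      ‖toL2 (partialD 0 f)‖ ^ 2 + ‖toL2 (partialD 1 f)‖ ^ 2 + ‖toL2 (partialD 2 f)‖ ^ 2 := by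
    rw [lapl_eq]
    simp only [map_add, inner_add_left, Complex.add_re, key]
    ring
  have h2 : -(⟪toL2 (lapl f), toL2 f⟫).re ≤ ‖toL2 (lapl f)‖ * ‖toL2 f‖ :=
    (neg_le_abs _).trans ((Complex.abs_re_le_norm _).trans (norm_inner_le_norm _ _))
  have h0 := sq_nonneg ‖toL2 (partialD 0 f)‖
  have h1 := sq_nonneg ‖toL2 (partialD 1 f)‖
  have h3 := sq_nonneg ‖toL2 (partialD 2 f)‖
  fin_cases i <;> simp only [Fin.zero_eta, Fin.mk_one, Fin.reduceFinMk] <;> linarith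

/-! ### Sobolev bound -/

section Sobolev

open FourierTransform Laplacian SchwartzMap Filter

/-- A test function as a Schwartz function. -/
def toSchwartz (f : testFun) : 𝓢(Space3, ℂ) := (hasCompactSupport f).toSchwartzMap (contDiff f)

theorem laplacian_toSchwartz (f : testFun) : Δ (toSchwartz f) = toSchwartz (lapl f) := by
  ext x
  rw [laplacian_eq_sum (EuclideanSpace.basisFun (Fin 3) ℝ), lapl_eq, Fin.sum_univ_three]
  simp only [EuclideanSpace.basisFun_apply]
  rfl

theorem fourier_lapl (f : testFun) (ξ : Space3) :
    𝓕 (toSchwartz (lapl f)) ξ = -(((2 * Real.pi) ^ 2 * ‖ξ‖ ^ 2 : ℝ) : ℂ) * 𝓕 (toSchwartz f) ξ := by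
  rw [← laplacian_toSchwartz, laplacian_eq_fourierMultiplierCLM, fourierMultiplierCLM_apply]
  have h : (fun x : Space3 => ‖x‖ ^ 2).HasTemperateGrowth := by fun_prop
  rw [FourierTransform.fourier_smul, FourierTransform.fourier_fourierInv_eq, _root_.smul_apply,
    smulLeftCLM_apply_apply (by fun_prop)]
  simp
  ring

theorem lintegral_enorm_fourier_sq (f : testFun) :
    ∫⁻ ξ, ‖𝓕 (toSchwartz f) ξ‖ₑ ^ 2 = ‖toL2 f‖ₑ ^ 2 := by
  have key : ∀ g : 𝓢(Space3, ℂ), ∫⁻ ξ, ‖g ξ‖ₑ ^ 2 = ENNReal.ofReal (∫ ξ, ‖g ξ‖ ^ 2) := by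
    intro g
    rw [ofReal_integral_eq_lintegral_ofReal]
    · refine lintegral_congr fun ξ => ?_
      rw [ENNReal.ofReal_pow (norm_nonneg _), ofReal_norm]
    · exact (g.memLp 2 volume).integrable_norm_pow (by simp)
    · exact .of_forall fun _ => by positivity
  rw [key, integral_norm_sq_fourier, ← key, enorm_toL2_sq]
  rfl

theorem enorm_le_lintegral_fourier (f : testFun) (x : Space3) :
    ‖(f : Space3 → ℂ) x‖ₑ ≤ ∫⁻ ξ, ‖𝓕 (toSchwartz f) ξ‖ₑ := by
  have h : (f : Space3 → ℂ) x = 𝓕⁻ (𝓕 (toSchwartz f)) x := by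
    rw [FourierTransform.fourierInv_fourier_eq]; rfl
  rw [h, fourierInv_coe, Real.fourierInv_eq]
  refine (enorm_integral_le_lintegral_enorm _).trans (lintegral_mono fun ξ => ?_)
  rw [← ofReal_norm, Circle.norm_smul, ofReal_norm]

/-- The weight of the Sobolev bound at frequency cutoff `n` has a finite square integral, which
tends to `0` as the cutoff grows. -/
theorem tendsto_lintegral_weight :
    Tendsto (fun n : ℕ => ∫⁻ ξ : Space3, ENNReal.ofReal ((n + 1 + ‖ξ‖ ^ 2) ^ 2)⁻¹) atTop
      (nhds 0) := by
  have h0 : ∫⁻ _ : Space3, (0 : ℝ≥0∞) = 0 := lintegral_zero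
  rw [← h0]
  -- The weight at `n = 0` dominates all the others; it decays like `‖ξ‖⁻⁴`, integrable because `4 >
  -- 3`.
  have hint : Integrable (fun ξ : Space3 => ((1 : ℝ) + ‖ξ‖ ^ 2) ^ (-(4 : ℝ) / 2)) :=
    integrable_rpow_neg_one_add_norm_sq (by simp; norm_num)
  refine tendsto_lintegral_of_dominated_convergence
    (fun ξ => ENNReal.ofReal ((1 + ‖ξ‖ ^ 2) ^ (-(4 : ℝ) / 2))) (fun n => ?_)
    (fun n => .of_forall fun ξ => ?_) hint.lintegral_lt_top.ne (.of_forall fun ξ => ?_)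
  · exact ENNReal.measurable_ofReal.comp (by fun_prop)
  · refine ENNReal.ofReal_le_ofReal ?_
    have h2 : -(4 : ℝ) / 2 = ((-2 : ℤ) : ℝ) := by norm_num
    rw [h2, Real.rpow_intCast, zpow_neg]
    change _ ≤ ((1 + ‖ξ‖ ^ 2) ^ 2)⁻¹
    have : (0 : ℝ) ≤ n := n.cast_nonneg
    gcongr ?_⁻¹
    exact pow_le_pow_left₀ (by positivity) (by linarith) 2
  · rw [← ENNReal.ofReal_zero]
    refine ENNReal.tendsto_ofReal (Tendsto.inv_tendsto_atTop ?_)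
    refine (tendsto_pow_atTop two_ne_zero).comp ?_
    exact tendsto_atTop_add_const_right _ _
      (tendsto_atTop_add_const_right _ _ tendsto_natCast_atTop_atTop)

/-- Fourier inversion and Cauchy–Schwarz after inserting the weight `n + 1 + ‖ξ‖²` and its inverse;
`‖ξ‖²` times the transform is dominated by the transform of `Δf`. -/
theorem enorm_apply_sq_le (n : ℕ) (f : testFun) (x : Space3) :
    ‖(f : Space3 → ℂ) x‖ₑ ^ 2 ≤ (∫⁻ ξ : Space3, ENNReal.ofReal ((n + 1 + ‖ξ‖ ^ 2) ^ 2)⁻¹) *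
      (2 * ‖toL2 (lapl f)‖ₑ ^ 2 + 2 * ((n + 1 : ℕ) : ℝ≥0∞) ^ 2 * ‖toL2 f‖ₑ ^ 2) := by
  set F := 𝓕 (toSchwartz f) with hF
  set G := 𝓕 (toSchwartz (lapl f)) with hG
  have hpos : ∀ ξ : Space3, (0 : ℝ) < n + 1 + ‖ξ‖ ^ 2 := fun ξ => by positivity
  have hmw : AEMeasurable (fun ξ : Space3 => ENNReal.ofReal (n + 1 + ‖ξ‖ ^ 2)⁻¹) :=
    (ENNReal.measurable_ofReal.comp (by fun_prop)).aemeasurable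
  have hmF : AEMeasurable (fun ξ : Space3 => ENNReal.ofReal (n + 1 + ‖ξ‖ ^ 2) * ‖F ξ‖ₑ) :=
    ((ENNReal.measurable_ofReal.comp (by fun_prop)).mul
      F.continuous.enorm.measurable).aemeasurable
  have h1 : ‖(f : Space3 → ℂ) x‖ₑ ≤ ∫⁻ ξ : Space3, ENNReal.ofReal (n + 1 + ‖ξ‖ ^ 2)⁻¹ *
      (ENNReal.ofReal (n + 1 + ‖ξ‖ ^ 2) * ‖F ξ‖ₑ) := by
    refine (enorm_le_lintegral_fourier f x).trans (lintegral_mono fun ξ => ?_)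
    rw [← mul_assoc, ← ENNReal.ofReal_mul (inv_nonneg.2 (hpos ξ).le), inv_mul_cancel₀ (hpos ξ).ne']
    simp [hF]
  have h2 := ENNReal.lintegral_mul_le_Lp_mul_Lq volume Real.HolderConjugate.two_two hmw hmF
  simp only [Pi.mul_apply] at h2
  have h3 : ‖(f : Space3 → ℂ) x‖ₑ ^ 2 ≤
      (∫⁻ ξ : Space3, ENNReal.ofReal (n + 1 + ‖ξ‖ ^ 2)⁻¹ ^ 2) *
      ∫⁻ ξ : Space3, (ENNReal.ofReal (n + 1 + ‖ξ‖ ^ 2) * ‖F ξ‖ₑ) ^ 2 := by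
    refine (pow_le_pow_left' (h1.trans h2) 2).trans (le_of_eq ?_)
    rw [mul_pow]
    simp only [← ENNReal.rpow_natCast, ← ENNReal.rpow_mul]
    norm_num
  refine h3.trans ?_
  gcongr ?_ * ?_
  · refine lintegral_mono fun ξ => ?_
    rw [← ENNReal.ofReal_pow (inv_nonneg.2 (hpos ξ).le), inv_pow]
  · rw [← lintegral_enorm_fourier_sq, ← lintegral_enorm_fourier_sq, ← hF, ← hG,
      ← lintegral_const_mul' _ _ (by simp), ← lintegral_const_mul' _ _ (by finiteness),
      ← lintegral_add_left (by fun_prop)]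
    refine lintegral_mono fun ξ => ?_
    have hGF : ‖F ξ‖ * ‖ξ‖ ^ 2 ≤ ‖G ξ‖ := by
      have h4 : 1 ≤ (2 * Real.pi) ^ 2 := by nlinarith [Real.pi_gt_three]
      rw [hG, fourier_lapl, norm_mul, norm_neg, Complex.norm_real, Real.norm_of_nonneg (by positivity)]
      nlinarith [mul_nonneg (norm_nonneg (F ξ)) (sq_nonneg ‖ξ‖)]
    have h5 : ((n + 1 + ‖ξ‖ ^ 2) * ‖F ξ‖) ^ 2 ≤ 2 * ‖G ξ‖ ^ 2 + 2 * (n + 1) ^ 2 * ‖F ξ‖ ^ 2 := by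
      have h6 : (‖F ξ‖ * ‖ξ‖ ^ 2) ^ 2 ≤ ‖G ξ‖ ^ 2 := pow_le_pow_left₀ (by positivity) hGF 2
      nlinarith [sq_nonneg (‖F ξ‖ * ‖ξ‖ ^ 2 - (n + 1) * ‖F ξ‖)]
    have h7 := ENNReal.ofReal_le_ofReal h5
    rw [ENNReal.ofReal_add (by positivity) (by positivity), ENNReal.ofReal_pow (by have := hpos ξ; positivity),
      ENNReal.ofReal_mul (hpos ξ).le, ENNReal.ofReal_mul (by positivity),
      ENNReal.ofReal_mul (by positivity), ENNReal.ofReal_mul (by positivity),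
      ENNReal.ofReal_pow (by positivity), ENNReal.ofReal_pow (by positivity),
      ENNReal.ofReal_pow (by positivity), ofReal_norm, ofReal_norm] at h7
    refine h7.trans (le_of_eq ?_)
    rw [ENNReal.ofReal_add (Nat.cast_nonneg n) zero_le_one]
    simp

theorem exists_enorm_apply_sq_le {ε : ℝ≥0∞} (hε : 0 < ε) :
    ∃ K : ℝ≥0∞, K ≠ ⊤ ∧ ∀ (f : testFun) (x : Space3),
      ‖(f : Space3 → ℂ) x‖ₑ ^ 2 ≤ ε * ‖toL2 (lapl f)‖ₑ ^ 2 + K * ‖toL2 f‖ₑ ^ 2 := by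
  -- The `ε / 2` absorbs the factor `2` before `‖Δf‖²`; the `1` lets the weight be dropped before
  -- `‖f‖²`.
  have h := tendsto_lintegral_weight.eventually_lt_const (u := min (ε / 2) 1)
    (lt_min (ENNReal.half_pos hε.ne') one_pos)
  obtain ⟨n, hn⟩ := h.exists
  refine ⟨2 * ((n + 1 : ℕ) : ℝ≥0∞) ^ 2, by finiteness, fun f x => ?_⟩
  refine (enorm_apply_sq_le n f x).trans ?_
  rw [mul_add]
  refine add_le_add ?_ ?_
  · rw [← mul_assoc]
    gcongr
    exact (mul_le_mul_left (hn.le.trans (min_le_left _ _)) 2).trans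
      (ENNReal.div_mul_cancel (by simp) (by simp)).le
  · exact mul_le_of_le_one_left' (hn.le.trans (min_le_right _ _))

end Sobolev

end testFun

/-- A smooth cutoff on the line, equal to `1` on `[0, 1]` and supported in `[-1, 2)`. -/
theorem exists_axial_cutoff : ∃ (ρ : ℝ → ℝ) (D : ℝ), ContDiff ℝ ∞ ρ ∧
    (∀ t, 0 ≤ t → t ≤ 1 → ρ t = 1) ∧ (∀ t, |ρ t| ≤ D ∧ |deriv ρ t| ≤ D ∧ |deriv (deriv ρ) t| ≤ D) ∧
    (∀ t, ¬ (-1 ≤ t ∧ t < 2) → ρ t = 0 ∧ deriv ρ t = 0 ∧ deriv (deriv ρ) t = 0) := by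
  -- The support is `[-1/2, 3/2]`. It is enlarged to `[-1, 2)` so that each translate by an integer
  -- meets exactly three half-open unit strips.
  let b : ContDiffBump (1 / 2 : ℝ) := ⟨1 / 2, 1, by norm_num, by norm_num⟩
  have hb : ContDiff ℝ ∞ b := b.contDiff
  have hb1 : ContDiff ℝ ∞ (deriv b) := (contDiff_infty_iff_deriv.1 hb).2
  have hb2 : ContDiff ℝ ∞ (deriv (deriv b)) := (contDiff_infty_iff_deriv.1 hb1).2
  have hc : HasCompactSupport b := b.hasCompactSupport
  obtain ⟨D0, h0⟩ := hc.exists_bound_of_continuous hb.continuous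
  obtain ⟨D1, h1⟩ := hc.deriv.exists_bound_of_continuous hb1.continuous
  obtain ⟨D2, h2⟩ := hc.deriv.deriv.exists_bound_of_continuous hb2.continuous
  refine ⟨b, max D0 (max D1 D2), hb, fun t ht ht' => ?_, fun t => ⟨?_, ?_, ?_⟩, fun t ht => ?_⟩
  · refine b.one_of_mem_closedBall ?_
    rw [Metric.mem_closedBall, Real.dist_eq, abs_le]
    constructor <;> simp only [b] <;> linarith
  · exact (h0 t).trans (le_max_left _ _)
  · exact (h1 t).trans ((le_max_left _ _).trans (le_max_right _ _))
  · exact (h2 t).trans ((le_max_right _ _).trans (le_max_right _ _))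
  · have hts : t ∉ tsupport b := by
      rw [b.tsupport_eq, Metric.mem_closedBall, Real.dist_eq, abs_le]
      rintro ⟨h3, h4⟩
      simp only [b] at h3 h4
      exact ht ⟨by linarith, by linarith⟩
    have hts1 : t ∉ tsupport (deriv b) := fun h => hts (tsupport_deriv_subset h)
    have hts2 : t ∉ tsupport (deriv (deriv b)) := fun h => hts1 (tsupport_deriv_subset h)
    exact ⟨image_eq_zero_of_notMem_tsupport hts, image_eq_zero_of_notMem_tsupport hts1,
      image_eq_zero_of_notMem_tsupport hts2⟩

namespace testFun

/-! ### Localization along the axis -/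

/-- Multiplication of a test function by a smooth function of the third coordinate. -/
def axialMul (φ : ℝ → ℝ) (hφ : ContDiff ℝ ∞ φ) (f : testFun) : testFun :=
  ⟨fun x => ((φ (x 2) : ℝ) : ℂ) * (f : Space3 → ℂ) x,
    (Complex.ofRealCLM.contDiff.comp (hφ.comp
      (EuclideanSpace.proj 2 : Space3 →L[ℝ] ℝ).contDiff)).mul
      (contDiff f),
    (hasCompactSupport f).mul_left⟩

theorem axialMul_apply (φ : ℝ → ℝ) (hφ : ContDiff ℝ ∞ φ) (f : testFun) (x : Space3) :
    (axialMul φ hφ f : Space3 → ℂ) x = ((φ (x 2) : ℝ) : ℂ) * (f : Space3 → ℂ) x := rfl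

theorem partialD_axialMul_apply (i : Fin 3) (φ : ℝ → ℝ) (hφ : ContDiff ℝ ∞ φ) (f : testFun)
    (x : Space3) :
    (partialD i (axialMul φ hφ f) : Space3 → ℂ) x = ((φ (x 2) : ℝ) : ℂ) * (partialD i f : Space3 → ℂ) x +
      (if i = 2 then ((deriv φ (x 2) : ℝ) : ℂ) else 0) * (f : Space3 → ℂ) x := by
  have h1 : HasFDerivAt (fun y : Space3 => φ (y 2)) _ x :=
    ((hφ.differentiable (by simp)) (x 2)).hasDerivAt.hasFDerivAt.comp x
      (EuclideanSpace.proj (𝕜 := ℝ) (2 : Fin 3)).hasFDerivAt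
  have h2 := (Complex.ofRealCLM.hasFDerivAt).comp x h1
  have h := (h2.mul (differentiable f x).hasFDerivAt).fderiv
  have h' := congrArg (fun L => L (EuclideanSpace.single i 1)) h
  refine Eq.trans (b := _) h' ?_
  by_cases hi : i = 2
  · subst hi
    simp [partialD_apply, mul_comm]
  · simp [partialD_apply, hi, Ne.symm hi]

theorem lapl_axialMul_apply (φ : ℝ → ℝ) (hφ : ContDiff ℝ ∞ φ) (f : testFun) (x : Space3) :
    (lapl (axialMul φ hφ f) : Space3 → ℂ) x = ((φ (x 2) : ℝ) : ℂ) * (lapl f : Space3 → ℂ) x +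
      2 * ((deriv φ (x 2) : ℝ) : ℂ) * (partialD 2 f : Space3 → ℂ) x +
      ((deriv (deriv φ) (x 2) : ℝ) : ℂ) * (f : Space3 → ℂ) x := by
  have hφ' : ContDiff ℝ ∞ (deriv φ) := (contDiff_infty_iff_deriv.1 hφ).2
  have h0 : ∀ i : Fin 3, i ≠ 2 → partialD i (axialMul φ hφ f) = axialMul φ hφ (partialD i f) := by
    intro i hi
    ext y
    rw [partialD_axialMul_apply, axialMul_apply]
    simp [hi]
  have h2 : partialD 2 (axialMul φ hφ f) =
      axialMul φ hφ (partialD 2 f) + axialMul (deriv φ) hφ' f := by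
    ext y
    rw [partialD_axialMul_apply, Submodule.coe_add, Pi.add_apply, axialMul_apply, axialMul_apply]
    simp
  rw [lapl_eq, lapl_eq, h0 0 (by decide), h0 1 (by decide), h2, map_add]
  simp only [Submodule.coe_add, Pi.add_apply, partialD_axialMul_apply]
  simp
  ring

theorem tsum_setLIntegral_strip (Q : Space3 → ℝ≥0∞) :
    ∑' n : ℤ, ∫⁻ x in {x : Space3 | (n : ℝ) ≤ x 2 ∧ x 2 < n + 1}, Q x = ∫⁻ x, Q x := by
  have hset : ∀ n : ℤ, {x : Space3 | (n : ℝ) ≤ x 2 ∧ x 2 < n + 1} = {x : Space3 | ⌊x 2⌋ = n} := by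
    intro n
    ext x
    exact Int.floor_eq_iff.symm
  simp only [hset]
  rw [← lintegral_iUnion]
  · have : ⋃ n : ℤ, {x : Space3 | ⌊x 2⌋ = n} = Set.univ := by
      ext x; simp
    rw [this, setLIntegral_univ]
  · intro n
    have : Measurable fun x : Space3 => ⌊x 2⌋ :=
      Int.measurable_floor.comp (EuclideanSpace.proj (𝕜 := ℝ) (2 : Fin 3)).continuous.measurable
    exact this (measurableSet_singleton n)
  · intro n m hnm
    refine Set.disjoint_left.2 fun x hx hx' => hnm ?_
    exact (show ⌊x 2⌋ = n from hx).symm.trans hx'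

theorem tsum_setLIntegral_wide_strip_le (Q : Space3 → ℝ≥0∞) :
    ∑' n : ℤ, ∫⁻ x in {x : Space3 | (n : ℝ) - 1 ≤ x 2 ∧ x 2 < n + 2}, Q x ≤ 3 * ∫⁻ x, Q x := by
  set a : ℤ → ℝ≥0∞ := fun n => ∫⁻ x in {x : Space3 | (n : ℝ) ≤ x 2 ∧ x 2 < n + 1}, Q x with ha
  have h : ∀ n : ℤ, ∫⁻ x in {x : Space3 | (n : ℝ) - 1 ≤ x 2 ∧ x 2 < n + 2}, Q x ≤
      a (n + -1) + a n + a (n + 1) := by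
    intro n
    refine (lintegral_mono_set (t := ({x : Space3 | ((n + -1 : ℤ) : ℝ) ≤ x 2 ∧ x 2 < (n + -1 : ℤ) + 1}
      ∪ {x : Space3 | (n : ℝ) ≤ x 2 ∧ x 2 < n + 1}) ∪
      {x : Space3 | ((n + 1 : ℤ) : ℝ) ≤ x 2 ∧ x 2 < (n + 1 : ℤ) + 1}) ?_).trans ?_
    · rintro x ⟨h1, h2⟩
      simp only [Set.mem_union, Set.mem_ofPred_eq]
      push_cast
      by_cases h3 : x 2 < n
      · exact Or.inl (Or.inl ⟨by linarith, by linarith⟩)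
      · by_cases h4 : x 2 < n + 1
        · exact Or.inl (Or.inr ⟨by linarith, h4⟩)
        · exact Or.inr ⟨by linarith, by linarith⟩
    · exact (lintegral_union_le _ _ _).trans (add_le_add_left (lintegral_union_le _ _ _) _)
  refine (ENNReal.tsum_le_tsum h).trans ?_
  rw [ENNReal.tsum_add, ENNReal.tsum_add]
  have e1 : ∑' n, a (n + -1) = ∑' n, a n := (Equiv.addRight (-1 : ℤ)).tsum_eq a
  have e2 : ∑' n, a (n + 1) = ∑' n, a n := (Equiv.addRight (1 : ℤ)).tsum_eq a
  rw [e1, e2, tsum_setLIntegral_strip]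
  exact le_of_eq (by ring)

theorem measurable_rPerp : Measurable rPerp := by
  unfold rPerp
  exact (by fun_prop : Continuous _).measurable

theorem lintegral_le_setLIntegral_of_le_indicator {S : Set Space3} (hS : MeasurableSet S) {u v : Space3 → ℝ≥0∞}
    (h : ∀ x, u x ≤ S.indicator v x) : ∫⁻ x, u x ≤ ∫⁻ x in S, v x :=
  (lintegral_mono h).trans (lintegral_indicator hS v).le

/-- A cutoff `φ` supported in a strip loses control of `f` only inside that strip. -/
theorem enorm_axialMul_bounds {φ : ℝ → ℝ} (hφ : ContDiff ℝ ∞ φ) {D : ℝ} {I : Set ℝ}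
    (hI : MeasurableSet I)
    (hD : ∀ t, |φ t| ≤ D ∧ |deriv φ t| ≤ D ∧ |deriv (deriv φ) t| ≤ D)
    (h0 : ∀ t, t ∉ I → φ t = 0 ∧ deriv φ t = 0 ∧ deriv (deriv φ) t = 0) (f : testFun) :
    ‖toL2 (lapl (axialMul φ hφ f))‖ₑ ^ 2 ≤ ENNReal.ofReal (6 * D ^ 2) *
      ∫⁻ x in {x : Space3 | x 2 ∈ I}, (‖(lapl f : Space3 → ℂ) x‖ₑ ^ 2 +
        ‖(partialD 2 f : Space3 → ℂ) x‖ₑ ^ 2 + ‖(f : Space3 → ℂ) x‖ₑ ^ 2) ∧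
    ‖toL2 (axialMul φ hφ f)‖ₑ ^ 2 ≤ ENNReal.ofReal (D ^ 2) *
      ∫⁻ x in {x : Space3 | x 2 ∈ I}, ‖(f : Space3 → ℂ) x‖ₑ ^ 2 := by
  have hDn : 0 ≤ D := (abs_nonneg _).trans (hD 0).1
  have hS : MeasurableSet {x : Space3 | x 2 ∈ I} :=
    (EuclideanSpace.proj (𝕜 := ℝ) (2 : Fin 3)).continuous.measurable hI
  rw [enorm_toL2_sq, enorm_toL2_sq, ← lintegral_const_mul' _ _ ENNReal.ofReal_ne_top,
    ← lintegral_const_mul' _ _ ENNReal.ofReal_ne_top]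
  refine ⟨lintegral_le_setLIntegral_of_le_indicator hS fun x => ?_, lintegral_le_setLIntegral_of_le_indicator hS fun x => ?_⟩
  · by_cases hx : x 2 ∈ I
    · rw [Set.indicator_of_mem (by exact hx), lapl_axialMul_apply]
      obtain ⟨d0, d1, d2⟩ := hD (x 2)
      set a := (lapl f : Space3 → ℂ) x
      set b := (partialD 2 f : Space3 → ℂ) x
      set c := (f : Space3 → ℂ) x
      have h1 : ‖(φ (x 2) : ℂ) * a + 2 * ((deriv φ (x 2) : ℝ) : ℂ) * b + ((deriv (deriv φ) (x 2) : ℝ) : ℂ) * c‖ ≤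
          D * ‖a‖ + 2 * D * ‖b‖ + D * ‖c‖ := by
        refine (norm_add₃_le).trans ?_
        simp only [norm_mul, Complex.norm_real, Real.norm_eq_abs, Complex.norm_ofNat]
        gcongr
      have h2 : ‖(φ (x 2) : ℂ) * a + 2 * ((deriv φ (x 2) : ℝ) : ℂ) * b + ((deriv (deriv φ) (x 2) : ℝ) : ℂ) * c‖ ^ 2 ≤
          6 * D ^ 2 * (‖a‖ ^ 2 + ‖b‖ ^ 2 + ‖c‖ ^ 2) := by
        refine (pow_le_pow_left₀ (norm_nonneg _) h1 2).trans ?_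
        -- The `6` is `1² + 2² + 1²` from Cauchy–Schwarz; the three squares are the terms of
        -- Lagrange's identity.
        nlinarith [mul_nonneg (sq_nonneg D) (sq_nonneg (2 * ‖a‖ - ‖b‖)),
          mul_nonneg (sq_nonneg D) (sq_nonneg (2 * ‖c‖ - ‖b‖)),
          mul_nonneg (sq_nonneg D) (sq_nonneg (‖a‖ - ‖c‖))]
      have h3 := ENNReal.ofReal_le_ofReal h2
      rwa [ENNReal.ofReal_mul (by positivity), ENNReal.ofReal_add (by positivity) (by positivity),
        ENNReal.ofReal_add (by positivity) (by positivity), ENNReal.ofReal_pow (norm_nonneg _),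
        ENNReal.ofReal_pow (norm_nonneg _), ENNReal.ofReal_pow (norm_nonneg _),
        ENNReal.ofReal_pow (norm_nonneg _), ofReal_norm, ofReal_norm, ofReal_norm,
        ofReal_norm] at h3
    · obtain ⟨d0, d1, d2⟩ := h0 (x 2) hx
      rw [lapl_axialMul_apply, d0, d1, d2]
      simp
  · by_cases hx : x 2 ∈ I
    · rw [Set.indicator_of_mem (by exact hx), axialMul_apply, enorm_mul, mul_pow,
        ENNReal.ofReal_pow hDn]
      gcongr
      rw [← ofReal_norm, Complex.norm_real]
      exact ENNReal.ofReal_le_ofReal (hD (x 2)).1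
    · rw [axialMul_apply, (h0 (x 2) hx).1]
      simp

/-! ### The infinitesimal bound inside the cylinder. -/

theorem measurableSet_slab (R : ℝ) (n : ℤ) :
    MeasurableSet {x : Space3 | (n : ℝ) ≤ x 2 ∧ x 2 ≤ (n : ℝ) + 1 ∧ rPerp x < R} := by
  have h2 : Measurable fun x : Space3 => x 2 :=
    (EuclideanSpace.proj (𝕜 := ℝ) (2 : Fin 3)).continuous.measurable
  exact (measurableSet_le measurable_const h2).inter
    ((measurableSet_le h2 measurable_const).inter
      (measurableSet_lt measurable_rPerp measurable_const))

/-- A potential that is uniformly `L²` on the slabs of a cylinder is infinitesimally bounded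
relative to the Laplacian. -/
theorem exists_setLIntegral_cylinder_le {V : Space3 → ℝ} {R M : ℝ}
    (hslab : ∀ n : ℤ,
      ∫⁻ x in {x : Space3 | (n : ℝ) ≤ x 2 ∧ x 2 ≤ (n : ℝ) + 1 ∧ rPerp x < R}, ‖V x‖ₑ ^ 2
        ≤ ENNReal.ofReal (M ^ 2)) {ε : ℝ≥0∞} (hε : 0 < ε) :
    ∃ K : ℝ≥0∞, K ≠ ⊤ ∧ ∀ f : testFun,
      ∫⁻ x in {x : Space3 | rPerp x < R}, ‖V x‖ₑ ^ 2 * ‖(f : Space3 → ℂ) x‖ₑ ^ 2 ≤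
        ε * ‖toL2 (lapl f)‖ₑ ^ 2 + K * ‖toL2 f‖ₑ ^ 2 := by
  obtain ⟨ρ, D, hρ, hρ1, hρD, hρ0⟩ := exists_axial_cutoff
  -- The factors are the slab bound of `V`, the loss from the cutoff, the overlap of the wide
  -- strips, and the `2` in `hQint`.
  set c : ℝ≥0∞ := ENNReal.ofReal (M ^ 2) * (ENNReal.ofReal (6 * D ^ 2) * (3 * 2)) with hc
  have hct : c ≠ ⊤ := by finiteness
  have hε' : 0 < ε / (c + 1) := ENNReal.div_pos hε.ne' (by finiteness)
  -- The `1` keeps the parameter finite even for `ε = ⊤`; the denominator `c + 1` cannot vanish.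
  obtain ⟨K, hK, hKf⟩ := exists_enorm_apply_sq_le (ε := min 1 (ε / (c + 1))) (by simp [hε'])
  set δ := min 1 (ε / (c + 1)) with hδ
  have hδt : δ ≠ ⊤ := ne_top_of_le_ne_top ENNReal.one_ne_top (min_le_left _ _)
  refine ⟨c * δ + ENNReal.ofReal (M ^ 2) * (K * ENNReal.ofReal (D ^ 2) * 3), by finiteness,
    fun f => ?_⟩
  have hsm : ∀ n : ℤ, ContDiff ℝ ∞ fun t : ℝ => ρ (t - n) := fun n =>
    hρ.comp (contDiff_id.sub contDiff_const)
  have hd1 : ∀ n : ℤ, deriv (fun t : ℝ => ρ (t - n)) = fun t => deriv ρ (t - n) := fun n => by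
    ext t; exact deriv_comp_sub_const _ _ _
  have hd2 : ∀ n : ℤ, deriv (deriv (fun t : ℝ => ρ (t - n))) = fun t => deriv (deriv ρ) (t - n) :=
    fun n => by rw [hd1]; ext t; exact deriv_comp_sub_const _ _ _
  set Q : Space3 → ℝ≥0∞ := fun x => ‖(lapl f : Space3 → ℂ) x‖ₑ ^ 2 +
        ‖(partialD 2 f : Space3 → ℂ) x‖ₑ ^ 2 + ‖(f : Space3 → ℂ) x‖ₑ ^ 2 with hQ
  set S : ℤ → Set Space3 := fun n => {x : Space3 | (n : ℝ) - 1 ≤ x 2 ∧ x 2 < n + 2} with hS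
  have hb : ∀ n : ℤ, _ := fun n => enorm_axialMul_bounds (hsm n) (D := D)
    (I := Set.Ico ((n : ℝ) - 1) (n + 2)) measurableSet_Ico
    (fun t => by rw [hd2, hd1]; exact hρD _)
    (fun t ht => by
      rw [hd2, hd1]
      exact hρ0 _ fun h => ht ⟨by linarith [h.1], by linarith [h.2]⟩) f
  have hslabf : ∀ n : ℤ, ∫⁻ x in {x : Space3 | (n : ℝ) ≤ x 2 ∧ x 2 ≤ (n : ℝ) + 1 ∧ rPerp x < R},
      ‖V x‖ₑ ^ 2 * ‖(f : Space3 → ℂ) x‖ₑ ^ 2 ≤ ENNReal.ofReal (M ^ 2) *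
      (δ * ENNReal.ofReal (6 * D ^ 2) * ∫⁻ x in S n, Q x) + ENNReal.ofReal (M ^ 2) *
      (K * ENNReal.ofReal (D ^ 2) * ∫⁻ x in S n, ‖(f : Space3 → ℂ) x‖ₑ ^ 2) := by
    intro n
    set s : ℝ≥0∞ := δ * ‖toL2 (lapl (axialMul _ (hsm n) f))‖ₑ ^ 2 +
      K * ‖toL2 (axialMul _ (hsm n) f)‖ₑ ^ 2 with hs
    have hst : s ≠ ⊤ := by finiteness
    calc _ ≤ ∫⁻ x in {x : Space3 | (n : ℝ) ≤ x 2 ∧ x 2 ≤ (n : ℝ) + 1 ∧ rPerp x < R},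
          ‖V x‖ₑ ^ 2 * s := by
          -- On the slab the translated cutoff equals `1`, so the sup bound `s` for the localized
          -- function bounds `f` itself and leaves the integral.
          refine setLIntegral_mono' (measurableSet_slab R n) fun x hx => ?_
          have h := hKf (axialMul _ (hsm n) f) x
          rw [axialMul_apply, hρ1 _ (by linarith [hx.1]) (by linarith [hx.2.1]), Complex.ofReal_one,
            one_mul] at h
          gcongr
      _ ≤ ENNReal.ofReal (M ^ 2) * s := by
          rw [lintegral_mul_const' _ _ hst]
          gcongr
          exact hslab n
      _ ≤ _ := by
          rw [← mul_add, hs]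
          refine mul_le_mul_right (add_le_add ?_ ?_) _
          · rw [mul_assoc]; exact mul_le_mul_right (hb n).1 _
          · rw [mul_assoc]; exact mul_le_mul_right (hb n).2 _
  have hQint : ∫⁻ x, Q x ≤ 2 * ‖toL2 (lapl f)‖ₑ ^ 2 + 2 * ‖toL2 f‖ₑ ^ 2 := by
    have hp : ‖toL2 (partialD 2 f)‖ₑ ^ 2 ≤ ‖toL2 (lapl f)‖ₑ ^ 2 + ‖toL2 f‖ₑ ^ 2 := by
      have h1 : ‖toL2 (partialD 2 f)‖ ^ 2 ≤ ‖toL2 (lapl f)‖ ^ 2 + ‖toL2 f‖ ^ 2 := by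
        nlinarith [norm_partialD_sq_le 2 f, sq_nonneg (‖toL2 (lapl f)‖ - ‖toL2 f‖),
          sq_nonneg (‖toL2 (lapl f)‖ + ‖toL2 f‖)]
      have h2 := ENNReal.ofReal_le_ofReal h1
      rwa [ENNReal.ofReal_add (by positivity) (by positivity), ENNReal.ofReal_pow (norm_nonneg _),
        ENNReal.ofReal_pow (norm_nonneg _), ENNReal.ofReal_pow (norm_nonneg _), ofReal_norm,
        ofReal_norm, ofReal_norm] at h2
    have hm : ∀ g : testFun, Measurable fun x => ‖(g : Space3 → ℂ) x‖ₑ ^ 2 := fun g =>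
      (contDiff g).continuous.enorm.measurable.pow_const 2
    rw [hQ, lintegral_add_right _ (hm f), lintegral_add_right _ (hm _), ← enorm_toL2_sq,
      ← enorm_toL2_sq, ← enorm_toL2_sq]
    refine (add_le_add_left (add_le_add_right hp _) _).trans (le_of_eq (by ring))
  have hcδ : c * δ ≤ ε := by
    calc c * δ ≤ (c + 1) * (ε / (c + 1)) :=
          mul_le_mul' le_self_add (min_le_right _ _)
      _ = ε := ENNReal.mul_div_cancel (by simp) (by finiteness)
  have hcover : {x : Space3 | rPerp x < R} ⊆
      ⋃ n : ℤ, {x : Space3 | (n : ℝ) ≤ x 2 ∧ x 2 ≤ (n : ℝ) + 1 ∧ rPerp x < R} := fun x hx =>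
    Set.mem_iUnion.2 ⟨⌊x 2⌋, Int.floor_le _, (Int.lt_floor_add_one _).le, hx⟩
  refine ((lintegral_mono_set hcover).trans (lintegral_iUnion_le _ _)).trans
    ((ENNReal.tsum_le_tsum hslabf).trans ?_)
  rw [ENNReal.tsum_add]
  simp only [ENNReal.tsum_mul_left]
  calc _ ≤ ENNReal.ofReal (M ^ 2) * (δ * ENNReal.ofReal (6 * D ^ 2) *
          (3 * (2 * ‖toL2 (lapl f)‖ₑ ^ 2 + 2 * ‖toL2 f‖ₑ ^ 2))) +
        ENNReal.ofReal (M ^ 2) * (K * ENNReal.ofReal (D ^ 2) * (3 * ‖toL2 f‖ₑ ^ 2)) := by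
        gcongr
        · exact (tsum_setLIntegral_wide_strip_le Q).trans (mul_le_mul_right hQint 3)
        · rw [enorm_toL2_sq f]
          exact tsum_setLIntegral_wide_strip_le _
    _ = c * δ * ‖toL2 (lapl f)‖ₑ ^ 2 + (c * δ + ENNReal.ofReal (M ^ 2) *
          (K * ENNReal.ofReal (D ^ 2) * 3)) * ‖toL2 f‖ₑ ^ 2 := by
        rw [hc]; ring
    _ ≤ _ := by gcongr

end testFun

/-! ### The cylinder surface, and measurability of the potential. -/

theorem rPerp_smul {t : ℝ} (ht : 0 ≤ t) (x : Space3) : rPerp (t • x) = t * rPerp x := by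
  have h : (t • x) 0 ^ 2 + (t • x) 1 ^ 2 = t ^ 2 * (x 0 ^ 2 + x 1 ^ 2) := by
    simp only [PiLp.smul_apply, smul_eq_mul]
    ring
  rw [rPerp, h, Real.sqrt_mul (sq_nonneg t), Real.sqrt_sq ht, rPerp]

theorem convex_rPerp_le (R : ℝ) : Convex ℝ {x : Space3 | rPerp x ≤ R} := by
  let L : Space3 →ₗ[ℝ] ℂ := Complex.equivRealProdCLM.symm.toLinearMap ∘ₗ
    ((EuclideanSpace.proj 0 : Space3 →L[ℝ] ℝ).toLinearMap.prod
      (EuclideanSpace.proj 1 : Space3 →L[ℝ] ℝ).toLinearMap)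
  have h : {x : Space3 | rPerp x ≤ R} = L ⁻¹' Metric.closedBall 0 R := by
    ext x
    have hL : ‖L x‖ = rPerp x := by
      rw [Complex.norm_eq_sqrt_sq_add_sq]
      rfl
    simp [← hL]
  rw [h]
  exact (convex_closedBall 0 R).linear_preimage L

/-- The surface `r_⊥ = R` falls under neither the slab nor the growth condition. Dilations by `t >
1` push its points out of the convex solid cylinder, so it lies in the frontier of a convex set,
which is null. -/
theorem volume_rPerp_eq {R : ℝ} (hR : 0 < R) : volume {x : Space3 | rPerp x = R} = 0 := by
  refine measure_mono_null (fun x hx => ?_) ((convex_rPerp_le R).addHaar_frontier volume)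
  refine ⟨subset_closure (le_of_eq hx), fun hint => ?_⟩
  have hc : Filter.Tendsto (fun t : ℝ => t • x) (nhds 1) (nhds x) := by
    have h : Continuous fun t : ℝ => t • x := by fun_prop
    simpa using h.tendsto 1
  have hev := (hc.eventually (mem_interior_iff_mem_nhds.1 hint)).filter_mono
    (nhdsWithin_le_nhds (s := Set.Ioi 1))
  obtain ⟨t, ht, ht1⟩ := (hev.and self_mem_nhdsWithin).exists
  have h1 : (1 : ℝ) < t := ht1
  have h2 : rPerp (t • x) ≤ R := ht
  rw [rPerp_smul (by linarith), show rPerp x = R from hx] at h2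
  nlinarith

theorem aestronglyMeasurable_of_memLp_compact {V : Space3 → ℝ}
    (hloc : ∀ K : Set Space3, IsCompact K → MemLp V 2 (volume.restrict K)) :
    AEStronglyMeasurable V volume := by
  have h : AEStronglyMeasurable V
      (volume.restrict (⋃ n : ℕ, Metric.closedBall (0 : Space3) n)) :=
    aestronglyMeasurable_iUnion_iff.2 fun n =>
      (hloc _ (isCompact_closedBall _ _)).aestronglyMeasurable
  rwa [Metric.iUnion_closedBall_nat, Measure.restrict_univ] at h

/-! ### The potential relative to the oscillator, on test functions. -/

namespace testFun

theorem eLpNorm_coe (f : testFun) :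
    eLpNorm (f : Space3 → ℂ) 2 volume = ENNReal.ofReal ‖toL2 f‖ := by
  rw [ofReal_norm]
  exact (Lp.enorm_toLp (memLp f)).symm

/-- One square in `oscillator_energy` is dropped, and `a² + b² ≤ (a + b)²` is applied with `b =
√(4w) ‖f‖`. -/
theorem norm_lapl_le {w : ℝ} (hw : 0 ≤ w) (f : testFun) :
    ‖toL2 (lapl f)‖ ≤ ‖toL2 (oscillator w f)‖ + 2 * √w * ‖toL2 f‖ := by
  refine abs_le_of_sq_le_sq' ?_ (by positivity) |>.2
  have h := oscillator_energy hw f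
  have h2 : (2 * √w * ‖toL2 f‖) ^ 2 = 4 * w * ‖toL2 f‖ ^ 2 := by
    rw [mul_pow, mul_pow, Real.sq_sqrt hw]; ring
  have h3 : 0 ≤ ‖toL2 (oscillator w f)‖ * (2 * √w * ‖toL2 f‖) := by positivity
  nlinarith [sq_nonneg (w * ‖toL2 (perpSq f)‖)]

theorem norm_perpSq_le {w : ℝ} (hw : 0 ≤ w) (f : testFun) :
    w * ‖toL2 (perpSq f)‖ ≤ ‖toL2 (oscillator w f)‖ + 2 * √w * ‖toL2 f‖ := by
  refine abs_le_of_sq_le_sq' ?_ (by positivity) |>.2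
  have h := oscillator_energy hw f
  have h2 : (2 * √w * ‖toL2 f‖) ^ 2 = 4 * w * ‖toL2 f‖ ^ 2 := by
    rw [mul_pow, mul_pow, Real.sq_sqrt hw]; ring
  have h3 : 0 ≤ ‖toL2 (oscillator w f)‖ * (2 * √w * ‖toL2 f‖) := by positivity
  nlinarith [sq_nonneg ‖toL2 (lapl f)‖]

theorem eLpNorm_cylinder_le {V : Space3 → ℝ} {R M : ℝ}
    (hslab : ∀ n : ℤ,
      ∫⁻ x in {x : Space3 | (n : ℝ) ≤ x 2 ∧ x 2 ≤ (n : ℝ) + 1 ∧ rPerp x < R}, ‖V x‖ₑ ^ 2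
        ≤ ENNReal.ofReal (M ^ 2)) {ε : ℝ} (hε : 0 < ε) :
    ∃ k : ℝ, 0 ≤ k ∧ ∀ f : testFun,
      eLpNorm ({x : Space3 | rPerp x < R}.indicator fun x => (V x : ℂ) * (f : Space3 → ℂ) x) 2
        volume ≤ ENNReal.ofReal (ε * ‖toL2 (lapl f)‖ + k * ‖toL2 f‖) := by
  obtain ⟨K, hK, h⟩ := exists_setLIntegral_cylinder_le hslab
    (ε := ENNReal.ofReal (ε ^ 2)) (by simp; positivity)
  obtain ⟨k, hk, rfl⟩ : ∃ k : ℝ, 0 ≤ k ∧ K = ENNReal.ofReal k :=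
    ⟨K.toReal, ENNReal.toReal_nonneg, (ENNReal.ofReal_toReal hK).symm⟩
  refine ⟨√k, Real.sqrt_nonneg _, fun f => ?_⟩
  have hS : MeasurableSet {x : Space3 | rPerp x < R} :=
    measurableSet_lt measurable_rPerp measurable_const
  rw [eLpNorm_indicator_eq_eLpNorm_restrict hS,
    eLpNorm_eq_lintegral_rpow_enorm_toReal (by simp) (by simp)]
  simp only [ENNReal.toReal_ofNat, one_div]
  rw [ENNReal.rpow_inv_le_iff (by norm_num)]
  have h2 := h f
  have e1 : ∀ x, ‖(V x : ℂ) * (f : Space3 → ℂ) x‖ₑ ^ (2 : ℝ) =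
      ‖V x‖ₑ ^ 2 * ‖(f : Space3 → ℂ) x‖ₑ ^ 2 := by
    intro x
    rw [ENNReal.rpow_two, enorm_mul, mul_pow]
    congr 2
    rw [← ofReal_norm, Complex.norm_real, ofReal_norm]
  simp only [e1]
  refine h2.trans ?_
  rw [← ofReal_norm, ← ofReal_norm, ENNReal.rpow_two,
    ← ENNReal.ofReal_pow (by positivity), ← ENNReal.ofReal_pow (by positivity),
    ← ENNReal.ofReal_pow (by positivity), ← ENNReal.ofReal_mul (by positivity),
    ← ENNReal.ofReal_mul (by positivity), ← ENNReal.ofReal_add (by positivity) (by positivity)]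
  refine ENNReal.ofReal_le_ofReal ?_
  rw [add_sq, mul_pow, mul_pow, Real.sq_sqrt hk]
  have : 0 ≤ 2 * (ε * ‖toL2 (lapl f)‖) * (√k * ‖toL2 f‖) := by positivity
  linarith

theorem eLpNorm_compl_cylinder_le {V : Space3 → ℝ} {R : ℝ} (hR : 0 < R) {C c : ℝ}
    (hgrowth : ∀ᵐ x : Space3, R < rPerp x → |V x| ≤ C + c * rPerp x ^ 2) (f : testFun) :
    eLpNorm ({x : Space3 | rPerp x < R}ᶜ.indicator fun x => (V x : ℂ) * (f : Space3 → ℂ) x) 2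
      volume ≤ ENNReal.ofReal (|C| * ‖toL2 f‖ + max c 0 * ‖toL2 (perpSq f)‖) := by
  have hnull : ∀ᵐ x : Space3, rPerp x ≠ R := by
    rw [ae_iff]; simpa using volume_rPerp_eq hR
  have h1 : eLpNorm ({x : Space3 | rPerp x < R}ᶜ.indicator fun x =>
      (V x : ℂ) * (f : Space3 → ℂ) x) 2 volume ≤
      eLpNorm ((fun x => |C| * ‖(f : Space3 → ℂ) x‖) +
        fun x => max c 0 * ‖(perpSq f : Space3 → ℂ) x‖) 2 volume := by
    refine eLpNorm_mono_ae ?_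
    filter_upwards [hgrowth, hnull] with x hx hne
    rw [Pi.add_apply, Real.norm_of_nonneg (by positivity)]
    by_cases hxR : rPerp x < R
    · rw [Set.indicator_of_notMem (by simpa using hxR), norm_zero]
      positivity
    · rw [Set.indicator_of_mem (by simpa using hxR), perpSq_apply, norm_mul, norm_mul,
        Complex.norm_real, Complex.norm_real, Real.norm_eq_abs,
        Real.norm_of_nonneg (sq_nonneg (rPerp x)), ← mul_assoc, ← add_mul]
      gcongr
      refine (hx (lt_of_le_of_ne (not_lt.1 hxR) hne.symm)).trans ?_
      gcongr
      · exact le_abs_self C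
      · exact le_max_left _ _
  have hm : ∀ (a : ℝ) (g : testFun),
      AEStronglyMeasurable (fun x => a * ‖(g : Space3 → ℂ) x‖) volume := fun a g =>
    (continuous_const.mul (contDiff g).continuous.norm).aestronglyMeasurable
  have he : ∀ (a : ℝ) (g : testFun), 0 ≤ a →
      eLpNorm (fun x => a * ‖(g : Space3 → ℂ) x‖) 2 volume = ENNReal.ofReal (a * ‖toL2 g‖) := by
    intro a g ha
    have h2 := eLpNorm_const_smul a (fun x => ‖(g : Space3 → ℂ) x‖) 2 (volume : Measure Space3)
    rw [eLpNorm_norm, eLpNorm_coe, ← ofReal_norm, Real.norm_of_nonneg ha,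
      ← ENNReal.ofReal_mul ha] at h2
    exact h2
  refine h1.trans ((eLpNorm_add_le (hm _ _) (hm _ _) (by norm_num)).trans ?_)
  rw [he _ _ (abs_nonneg C), he _ _ (le_max_right c 0), ENNReal.ofReal_add (by positivity)
    (by positivity)]

/-- The potential is bounded relative to the oscillator, with bound less than `1`. -/
theorem exists_oscillator_bound {w : ℝ} (hw : 0 < w) {V : Space3 → ℝ}
    (hV : AEStronglyMeasurable V volume) {R : ℝ} (hR : 0 < R) {M : ℝ}
    (hslab : ∀ n : ℤ,
      ∫⁻ x in {x : Space3 | (n : ℝ) ≤ x 2 ∧ x 2 ≤ (n : ℝ) + 1 ∧ rPerp x < R}, ‖V x‖ₑ ^ 2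
        ≤ ENNReal.ofReal (M ^ 2)) {C c : ℝ} (hc : c < w)
    (hgrowth : ∀ᵐ x : Space3, R < rPerp x → |V x| ≤ C + c * rPerp x ^ 2) :
    ∃ b₁ b₂ : ℝ, 0 ≤ b₁ ∧ b₁ < 1 ∧ 0 ≤ b₂ ∧ ∀ f : testFun,
      eLpNorm (fun x => (V x : ℂ) * (f : Space3 → ℂ) x) 2 volume ≤
        ENNReal.ofReal (b₁ * ‖toL2 (oscillator w f)‖ + b₂ * ‖toL2 f‖) := by
  -- The region outside the cylinder uses up `q < 1`; the region inside is given half of the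
  -- remaining gap, so the total is `(1 + q) / 2`.
  set q : ℝ := max c 0 / w with hq
  have hq0 : 0 ≤ q := by positivity
  have hq1 : q < 1 := (div_lt_one hw).2 (max_lt hc hw)
  obtain ⟨k, hk, hcyl⟩ := eLpNorm_cylinder_le hslab (ε := (1 - q) / 2) (by linarith)
  refine ⟨(1 - q) / 2 + q, ((1 - q) / 2 + q) * (2 * √w) + k + |C|, by linarith, by linarith,
    by have : 0 ≤ (1 - q) / 2 + q := by linarith
       positivity, fun f => ?_⟩
  have hS : MeasurableSet {x : Space3 | rPerp x < R} :=
    measurableSet_lt measurable_rPerp measurable_const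
  have hVf : AEStronglyMeasurable (fun x => (V x : ℂ) * (f : Space3 → ℂ) x) volume :=
    (Complex.continuous_ofReal.comp_aestronglyMeasurable hV).mul
      (contDiff f).continuous.aestronglyMeasurable
  have hsplit := Set.indicator_self_add_compl {x : Space3 | rPerp x < R}
    fun x => (V x : ℂ) * (f : Space3 → ℂ) x
  rw [← hsplit]
  refine (eLpNorm_add_le (hVf.indicator hS) (hVf.indicator hS.compl) (by norm_num)).trans ?_
  refine (add_le_add (hcyl f) (eLpNorm_compl_cylinder_le hR hgrowth f)).trans ?_
  have hε : 0 < (1 - q) / 2 := by linarith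
  rw [← ENNReal.ofReal_add (by positivity) (by positivity)]
  refine ENNReal.ofReal_le_ofReal ?_
  have h1 := mul_le_mul_of_nonneg_left (norm_lapl_le hw.le f) hε.le
  have h2 := mul_le_mul_of_nonneg_left (norm_perpSq_le hw.le f) hq0
  have h3 : q * (w * ‖toL2 (perpSq f)‖) = max c 0 * ‖toL2 (perpSq f)‖ := by
    rw [hq]; field_simp
  rw [h3] at h2
  linarith

end testFun

/-! ### Rotations about the axis -/

/-- The rotation by the angle `θ` about the third axis, as a linear map. -/
def rotLin (θ : ℝ) : Space3 →ₗ[ℝ] Space3 where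
  toFun x := !₂[Real.cos θ * x 0 - Real.sin θ * x 1, Real.sin θ * x 0 + Real.cos θ * x 1, x 2]
  map_add' x y := by
    ext i
    fin_cases i <;> simp <;> ring
  map_smul' c x := by
    ext i
    fin_cases i <;> simp <;> ring

theorem rotLin_zero (x : Space3) : rotLin 0 x = x := by
  ext i
  fin_cases i <;> simp [rotLin]

theorem rotLin_rotLin (a b : ℝ) (x : Space3) : rotLin a (rotLin b x) = rotLin (a + b) x := by
  ext i
  fin_cases i <;> simp [rotLin, Real.cos_add, Real.sin_add] <;> ring

/-- The rotation by the angle `θ` about the third axis. -/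
def rotIso (θ : ℝ) : Space3 ≃ₗᵢ[ℝ] Space3 where
  toLinearEquiv := LinearEquiv.ofLinearMap (rotLin θ) (rotLin (-θ))
    (by ext1 x; simp [rotLin_rotLin, rotLin_zero]) (by ext1 x; simp [rotLin_rotLin, rotLin_zero])
  norm_map' x := by
    rw [EuclideanSpace.norm_eq, EuclideanSpace.norm_eq]
    congr 1
    simp only [Fin.sum_univ_three, Real.norm_eq_abs, sq_abs, LinearEquiv.coe_ofLinearMap]
    simp [rotLin]
    nlinarith [Real.sin_sq_add_cos_sq θ]

theorem rotIso_apply (θ : ℝ) (x : Space3) : rotIso θ x = rotLin θ x := rfl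

theorem rotIso_apply_zero (θ : ℝ) (x : Space3) :
    rotIso θ x 0 = Real.cos θ * x 0 - Real.sin θ * x 1 := rfl

theorem rotIso_apply_one (θ : ℝ) (x : Space3) :
    rotIso θ x 1 = Real.sin θ * x 0 + Real.cos θ * x 1 := rfl

theorem hasDerivAt_rotIso (x : Space3) (θ : ℝ) :
    HasDerivAt (fun t => rotIso t x)
      (EuclideanSpace.single 1 (rotIso θ x 0) - EuclideanSpace.single 0 (rotIso θ x 1)) θ := by
  have h : (fun t => rotIso t x) = fun t => Real.cos t • (!₂[x 0, x 1, 0] : Space3) +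
      Real.sin t • (!₂[-x 1, x 0, 0] : Space3) + !₂[0, 0, x 2] := by
    ext t i
    fin_cases i <;> simp [rotIso_apply, rotLin] <;> ring
  rw [h]
  refine ((((Real.hasDerivAt_cos θ).smul_const _).add
    ((Real.hasDerivAt_sin θ).smul_const _)).add_const _).congr_deriv ?_
  ext i
  fin_cases i <;> simp [rotIso_apply, rotLin] <;> ring

namespace testFun

/-- The action of rotations on test functions. -/
def rot (θ : ℝ) : Module.End ℂ testFun where
  toFun f := ⟨fun x => (f : Space3 → ℂ) (rotIso θ x),
    (contDiff f).comp (rotIso θ).toContinuousLinearEquiv.contDiff,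
    (hasCompactSupport f).comp_homeomorph (rotIso θ).toHomeomorph⟩
  map_add' _ _ := rfl
  map_smul' _ _ := rfl

theorem rot_apply (θ : ℝ) (f : testFun) (x : Space3) :
    (rot θ f : Space3 → ℂ) x = (f : Space3 → ℂ) (rotIso θ x) := rfl

theorem rot_zero (f : testFun) : rot 0 f = f := by
  ext x
  rw [rot_apply, rotIso_apply, rotLin_zero]

theorem rot_rot (a b : ℝ) (f : testFun) : rot a (rot b f) = rot (b + a) f := by
  ext x
  simp only [rot_apply, rotIso_apply, rotLin_rotLin]

theorem norm_toL2_rot (θ : ℝ) (f : testFun) : ‖toL2 (rot θ f)‖ = ‖toL2 f‖ := by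
  have h : ‖toL2 (rot θ f)‖ₑ ^ 2 = ‖toL2 f‖ₑ ^ 2 := by
    rw [enorm_toL2_sq, enorm_toL2_sq]
    exact (rotIso θ).measurePreserving.lintegral_comp_emb
      (rotIso θ).toHomeomorph.measurableEmbedding fun x => ‖(f : Space3 → ℂ) x‖ₑ ^ 2
  have h2 := congrArg ENNReal.toReal h
  rw [ENNReal.toReal_pow, ENNReal.toReal_pow, toReal_enorm, toReal_enorm] at h2
  exact (pow_left_inj₀ (norm_nonneg _) (norm_nonneg _) two_ne_zero).1 h2

theorem partialD_rot_apply (i : Fin 3) (θ : ℝ) (f : testFun) (x : Space3) :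
    (partialD i (rot θ f) : Space3 → ℂ) x =
      fderiv ℝ (f : Space3 → ℂ) (rotIso θ x) (rotIso θ (EuclideanSpace.single i 1)) := by
  have h := (differentiable f (rotIso θ x)).hasFDerivAt.comp x
    (rotIso θ).toContinuousLinearEquiv.hasFDerivAt
  exact congrArg (fun L => L (EuclideanSpace.single i 1)) h.fderiv

theorem partialD_zero_rot (θ : ℝ) (f : testFun) : partialD 0 (rot θ f) =
    rot θ ((Real.cos θ : ℂ) • partialD 0 f + (Real.sin θ : ℂ) • partialD 1 f) := by
  ext x
  have h : rotIso θ (EuclideanSpace.single 0 1) =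
      Real.cos θ • EuclideanSpace.single 0 1 + Real.sin θ • EuclideanSpace.single 1 1 := by
    ext i
    fin_cases i <;> simp [rotIso_apply, rotLin]
  rw [partialD_rot_apply, h, map_add, map_smul, map_smul]
  simp only [Complex.real_smul]
  rfl

theorem partialD_one_rot (θ : ℝ) (f : testFun) : partialD 1 (rot θ f) =
    rot θ (-(Real.sin θ : ℂ) • partialD 0 f + (Real.cos θ : ℂ) • partialD 1 f) := by
  ext x
  have h : rotIso θ (EuclideanSpace.single 1 1) =
      -Real.sin θ • EuclideanSpace.single 0 1 + Real.cos θ • EuclideanSpace.single 1 1 := by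
    ext i
    fin_cases i <;> simp [rotIso_apply, rotLin]
  rw [partialD_rot_apply, h, map_add, map_smul, map_smul]
  simp only [Complex.real_smul, Complex.ofReal_neg]
  rfl

theorem partialD_two_rot (θ : ℝ) (f : testFun) : partialD 2 (rot θ f) = rot θ (partialD 2 f) := by
  ext x
  have h : rotIso θ (EuclideanSpace.single 2 1) = EuclideanSpace.single 2 1 := by
    ext i
    fin_cases i <;> simp [rotIso_apply, rotLin]
  rw [partialD_rot_apply, h]
  rfl

theorem lapl_rot (θ : ℝ) (f : testFun) : lapl (rot θ f) = rot θ (lapl f) := by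
  rw [lapl_eq, lapl_eq, partialD_zero_rot, partialD_zero_rot, partialD_one_rot, partialD_one_rot,
    partialD_two_rot, partialD_two_rot, ← map_add, ← map_add]
  congr 1
  have h : (Real.sin θ : ℂ) ^ 2 + (Real.cos θ : ℂ) ^ 2 = 1 := by
    exact_mod_cast Real.sin_sq_add_cos_sq θ
  ext x
  simp only [map_add, map_smul, Submodule.coe_add, Submodule.coe_smul, Pi.add_apply,
    Pi.smul_apply, smul_eq_mul]
  linear_combination ((partialD 0 (partialD 0 f) : Space3 → ℂ) x +
    (partialD 1 (partialD 1 f) : Space3 → ℂ) x) * h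

theorem perpSq_rot (θ : ℝ) (f : testFun) : perpSq (rot θ f) = rot θ (perpSq f) := by
  ext x
  have h : rPerp (rotIso θ x) = rPerp x := by
    unfold rPerp
    congr 1
    rw [rotIso_apply_zero, rotIso_apply_one]
    linear_combination (x 0 ^ 2 + x 1 ^ 2) * Real.sin_sq_add_cos_sq θ
  rw [rot_apply, perpSq_apply, perpSq_apply, h, rot_apply]

theorem angMom_apply (f : testFun) (x : Space3) : (angMom f : Space3 → ℂ) x =
    -Complex.I * (((x 0 : ℝ) : ℂ) * (partialD 1 f : Space3 → ℂ) x -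
      ((x 1 : ℝ) : ℂ) * (partialD 0 f : Space3 → ℂ) x) := rfl

theorem angMom_rot (θ : ℝ) (f : testFun) : angMom (rot θ f) = rot θ (angMom f) := by
  ext x
  rw [rot_apply, angMom_apply, angMom_apply, partialD_zero_rot, partialD_one_rot, rot_apply,
    rot_apply, rotIso_apply_zero, rotIso_apply_one]
  simp only [Submodule.coe_add, Submodule.coe_smul, Pi.add_apply,
    Pi.smul_apply, smul_eq_mul]
  push_cast
  ring

theorem magnetic_eq (B : ℝ) (f : testFun) :
    magnetic B f = oscillator (B ^ 2 / 4) f - (B : ℂ) • angMom f := by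
  simp only [magnetic, oscillator, perpSq, LinearMap.add_apply, LinearMap.sub_apply,
    LinearMap.neg_apply, LinearMap.smul_apply]
  abel

theorem magnetic_rot (B θ : ℝ) (f : testFun) : magnetic B (rot θ f) = rot θ (magnetic B f) := by
  simp only [magnetic_eq, oscillator, LinearMap.add_apply, LinearMap.neg_apply,
    LinearMap.smul_apply, lapl_rot, perpSq_rot, angMom_rot, map_sub, map_add, map_neg, map_smul]

/-! ### The rotation group twisted by a character -/

/-- The rotation by `θ` times the phase `exp (-i m θ)`; it fixes the sector of angular
momentum `m`. -/
def twist (m : ℤ) (θ : ℝ) : Module.End ℂ testFun :=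
  Complex.exp (-(m * θ * Complex.I)) • rot θ

theorem twist_eq (m : ℤ) (θ : ℝ) (f : testFun) :
    twist m θ f = Complex.exp (-(m * θ * Complex.I)) • rot θ f := rfl

theorem twist_apply (m : ℤ) (θ : ℝ) (f : testFun) (x : Space3) : (twist m θ f : Space3 → ℂ) x =
    Complex.exp (-(m * θ * Complex.I)) * (f : Space3 → ℂ) (rotIso θ x) := rfl

theorem norm_phase (m : ℤ) (θ : ℝ) : ‖Complex.exp (-(m * θ * Complex.I))‖ = 1 := by
  have h : -((m : ℂ) * θ * Complex.I) = ((-(m * θ) : ℝ) : ℂ) * Complex.I := by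
    push_cast; ring
  rw [h, Complex.norm_exp_ofReal_mul_I]

theorem norm_toL2_twist (m : ℤ) (θ : ℝ) (f : testFun) : ‖toL2 (twist m θ f)‖ = ‖toL2 f‖ := by
  rw [twist_eq, map_smul, norm_smul, norm_phase, one_mul, norm_toL2_rot]

theorem twist_zero (m : ℤ) (f : testFun) : twist m 0 f = f := by
  rw [twist_eq, rot_zero]
  simp

theorem twist_twist (m : ℤ) (a b : ℝ) (f : testFun) :
    twist m a (twist m b f) = twist m (b + a) f := by
  rw [twist_eq, twist_eq, twist_eq, map_smul, rot_rot, smul_smul, ← Complex.exp_add]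
  congr 2
  push_cast
  ring

/-- Integrality of `m` enters here: the phase is also `2π`-periodic, so the twisted rotations form a
circle action. -/
theorem twist_two_pi (m : ℤ) (f : testFun) : twist m (2 * Real.pi) f = f := by
  have h : Complex.exp (-(m * (2 * Real.pi : ℝ) * Complex.I)) = 1 := by
    rw [Complex.exp_eq_one_iff]
    exact ⟨-m, by push_cast; ring⟩
  have h2 : rot (2 * Real.pi) f = f := by
    ext x
    rw [rot_apply]
    have hx : rotIso (2 * Real.pi) x = x := by
      ext i
      fin_cases i <;> simp [rotIso_apply, rotLin]
    rw [hx]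
  rw [twist_eq, h, one_smul, h2]

/-- The generator `i (L_z - m)` of the twisted rotation group. -/
def twistGen (m : ℤ) : Module.End ℂ testFun := Complex.I • (angMom - (m : ℂ) • 1)

theorem twistGen_eq (m : ℤ) (f : testFun) :
    twistGen m f = Complex.I • (angMom f - (m : ℂ) • f) := rfl

theorem hasDerivAt_twist_apply (m : ℤ) (f : testFun) (x : Space3) (θ : ℝ) :
    HasDerivAt (fun t => (twist m t f : Space3 → ℂ) x)
      ((twist m θ (twistGen m f) : Space3 → ℂ) x) θ := by
  have h1 : HasDerivAt (fun t : ℝ => Complex.exp (-(m * t * Complex.I)))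
      (Complex.exp (-(m * θ * Complex.I)) * -(m * Complex.I)) θ := by
    refine HasDerivAt.cexp ?_
    have h := (((Complex.ofRealCLM.hasDerivAt (x := θ)).const_mul (m : ℂ)).mul_const
      Complex.I).neg
    refine h.congr_deriv ?_
    simp
  have h2 := (differentiable f (rotIso θ x)).hasFDerivAt.comp_hasDerivAt θ (hasDerivAt_rotIso x θ)
  refine (h1.mul h2).congr_deriv ?_
  have hs : ∀ (i : Fin 3) (a : ℝ), EuclideanSpace.single i a =
      a • (EuclideanSpace.single i 1 : Space3) := by
    intro i a; ext j; by_cases h : j = i <;> simp [h]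
  rw [hs 1, hs 0, map_sub, map_smul, map_smul, Complex.real_smul, Complex.real_smul,
    ← partialD_apply, ← partialD_apply, twist_apply]
  change _ = _ * (Complex.I * ((angMom f : Space3 → ℂ) (rotIso θ x) -
    (m : ℂ) * (f : Space3 → ℂ) (rotIso θ x)))
  rw [angMom_apply]
  simp only [Function.comp_apply]
  linear_combination (Complex.exp (-(m * θ * Complex.I)) *
    (((rotIso θ x 0 : ℝ) : ℂ) * (partialD 1 f : Space3 → ℂ) (rotIso θ x) -
      ((rotIso θ x 1 : ℝ) : ℂ) * (partialD 0 f : Space3 → ℂ) (rotIso θ x))) * Complex.I_mul_I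

/-! ### Differentiability of the twisted rotations in `L²`. -/

theorem norm_toL2_le_of_bounded {r : ℝ} (f : testFun) {s : ℝ} (hs : 0 ≤ s)
    (hf : ∀ x, ‖(f : Space3 → ℂ) x‖ ≤ s) (h0 : ∀ x : Space3, r < ‖x‖ → (f : Space3 → ℂ) x = 0) :
    ‖toL2 f‖ ≤ s * √(volume (Metric.closedBall (0 : Space3) r)).toReal := by
  have h : ‖toL2 f‖ₑ ^ 2 ≤ ENNReal.ofReal s ^ 2 * volume (Metric.closedBall (0 : Space3) r) := by
    rw [enorm_toL2_sq, ← setLIntegral_const]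
    refine lintegral_le_setLIntegral_of_le_indicator Metric.isClosed_closedBall.measurableSet fun x => ?_
    by_cases hx : x ∈ Metric.closedBall (0 : Space3) r
    · rw [Set.indicator_of_mem hx, ← ofReal_norm]
      gcongr
      exact hf x
    · rw [h0 x (by simpa using hx)]
      simp
  have h2 := ENNReal.toReal_mono (ENNReal.mul_ne_top (by finiteness)
    measure_closedBall_lt_top.ne) h
  rw [ENNReal.toReal_mul, ENNReal.toReal_pow, ENNReal.toReal_pow, toReal_enorm,
    ENNReal.toReal_ofReal hs] at h2
  refine abs_le_of_sq_le_sq' ?_ (by positivity) |>.2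
  rwa [mul_pow, Real.sq_sqrt ENNReal.toReal_nonneg]

theorem exists_bound (f : testFun) : ∃ s, 0 ≤ s ∧ ∀ x, ‖(f : Space3 → ℂ) x‖ ≤ s := by
  obtain ⟨s, hs⟩ := (hasCompactSupport f).exists_bound_of_continuous (contDiff f).continuous
  exact ⟨s, (norm_nonneg _).trans (hs 0), hs⟩

theorem norm_twist_apply_sub_le (m : ℤ) (f : testFun) {s : ℝ}
    (hs : ∀ x, ‖(twistGen m f : Space3 → ℂ) x‖ ≤ s) (t : ℝ) (x : Space3) :
    ‖(twist m t f : Space3 → ℂ) x - (f : Space3 → ℂ) x‖ ≤ s * |t| := by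
  have h := convex_univ.norm_image_sub_le_of_norm_hasDerivWithin_le (C := s)
    (fun u _ => (hasDerivAt_twist_apply m f x u).hasDerivWithinAt)
    (fun u _ => by rw [twist_apply, norm_mul, norm_phase, one_mul]; exact hs _)
    (Set.mem_univ (0 : ℝ)) (Set.mem_univ t)
  rwa [twist_zero, sub_zero] at h

theorem norm_twist_apply_taylor_le (m : ℤ) (f : testFun) {s : ℝ} (hs0 : 0 ≤ s)
    (hs : ∀ x, ‖(twistGen m (twistGen m f) : Space3 → ℂ) x‖ ≤ s) (t : ℝ) (x : Space3) :
    ‖(twist m t f : Space3 → ℂ) x - (f : Space3 → ℂ) x - t * (twistGen m f : Space3 → ℂ) x‖ ≤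
      s * t ^ 2 := by
  have hd : ∀ u : ℝ, HasDerivAt
      (fun u : ℝ => (twist m u f : Space3 → ℂ) x - u * (twistGen m f : Space3 → ℂ) x)
      ((twist m u (twistGen m f) : Space3 → ℂ) x - (twistGen m f : Space3 → ℂ) x) u := by
    intro u
    have h := (Complex.ofRealCLM.hasDerivAt (x := u)).mul_const ((twistGen m f : Space3 → ℂ) x)
    refine ((hasDerivAt_twist_apply m f x u).sub h).congr_deriv ?_
    simp
  have h := (convex_uIcc 0 t).norm_image_sub_le_of_norm_hasDerivWithin_le (C := s * |t|)
    (fun u _ => (hd u).hasDerivWithinAt)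
    (fun u hu => (norm_twist_apply_sub_le m (twistGen m f) hs u x).trans (by
      have : |u| ≤ |t| := by simpa using Set.abs_sub_left_of_mem_uIcc hu
      gcongr))
    Set.left_mem_uIcc Set.right_mem_uIcc
  rw [twist_zero, Real.norm_eq_abs, sub_zero, mul_assoc, abs_mul_abs_self, ← sq] at h
  refine le_of_eq_of_le (congrArg norm ?_) h
  push_cast
  ring

/-- Rotations preserve balls about the origin, so the remainders for all `t` are supported in one
ball and the uniform pointwise estimate becomes an `L²` estimate. -/
theorem exists_norm_twist_taylor_le (m : ℤ) (f : testFun) : ∃ K : ℝ, 0 ≤ K ∧ ∀ t : ℝ,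
    ‖toL2 (twist m t f) - toL2 f - (t : ℂ) • toL2 (twistGen m f)‖ ≤ K * t ^ 2 := by
  obtain ⟨s, hs0, hs⟩ := exists_bound (twistGen m (twistGen m f))
  have hr : ∀ g : testFun, ∃ r : ℝ, ∀ x : Space3, r < ‖x‖ → (g : Space3 → ℂ) x = 0 := by
    intro g
    obtain ⟨r, hr⟩ := (hasCompactSupport g).isCompact.isBounded.subset_closedBall 0
    refine ⟨r, fun x hx => image_eq_zero_of_notMem_tsupport fun h => ?_⟩
    have := hr h
    rw [mem_closedBall_zero_iff] at this
    exact absurd this (not_le.2 hx)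
  obtain ⟨r1, hr1⟩ := hr f
  obtain ⟨r2, hr2⟩ := hr (twistGen m f)
  refine ⟨s * √(volume (Metric.closedBall (0 : Space3) (max r1 r2))).toReal, by positivity,
    fun t => ?_⟩
  rw [← map_sub, ← map_smul, ← map_sub]
  refine (norm_toL2_le_of_bounded _ (s := s * t ^ 2) (r := max r1 r2) (by positivity)
    (fun x => norm_twist_apply_taylor_le m f hs0 hs t x) fun x hx => ?_).trans (le_of_eq (by ring))
  change Complex.exp _ * (f : Space3 → ℂ) (rotIso t x) - (f : Space3 → ℂ) x -
    (t : ℂ) * (twistGen m f : Space3 → ℂ) x = 0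
  rw [hr1 x ((le_max_left _ _).trans_lt hx), hr2 x ((le_max_right _ _).trans_lt hx),
    hr1 _ (by rw [LinearIsometryEquiv.norm_map]; exact (le_max_left _ _).trans_lt hx)]
  simp

theorem twist_add (m : ℤ) (a t : ℝ) (f : testFun) :
    twist m (a + t) f = twist m a (twist m t f) := by
  rw [twist_twist, add_comm]

theorem hasDerivAt_toL2_twist (m : ℤ) (f : testFun) (a : ℝ) :
    HasDerivAt (fun t => toL2 (twist m t f)) (toL2 (twist m a (twistGen m f))) a := by
  obtain ⟨K, hK0, hK⟩ := exists_norm_twist_taylor_le m f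
  rw [hasDerivAt_iff_isLittleO_nhds_zero]
  refine Asymptotics.IsBigO.trans_isLittleO (g := fun t : ℝ => t ^ 2) ?_
    (Asymptotics.isLittleO_pow_id one_lt_two)
  refine Asymptotics.IsBigO.of_bound K (.of_forall fun t => ?_)
  have h : toL2 (twist m (a + t) f) - toL2 (twist m a f) - t • toL2 (twist m a (twistGen m f)) =
      toL2 (twist m a (twist m t f - f - (t : ℂ) • twistGen m f)) := by
    rw [twist_add, map_sub, map_sub, map_smul, map_sub, map_sub, map_smul, Complex.coe_smul]
    rfl
  rw [h, norm_toL2_twist, Real.norm_of_nonneg (sq_nonneg t), map_sub, map_sub, map_smul]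
  exact hK t

theorem norm_toL2_twist_sub_le (m : ℤ) (f : testFun) (t : ℝ) :
    ‖toL2 (twist m t f) - toL2 f‖ ≤ ‖toL2 (twistGen m f)‖ * |t| := by
  have h := convex_univ.norm_image_sub_le_of_norm_hasDerivWithin_le (C := ‖toL2 (twistGen m f)‖)
    (fun u _ => (hasDerivAt_toL2_twist m f u).hasDerivWithinAt)
    (fun u _ => by rw [norm_toL2_twist])
    (Set.mem_univ (0 : ℝ)) (Set.mem_univ t)
  rwa [twist_zero, sub_zero] at h

/-! ### Averages over finite rotation groups -/

/-- The average of a test function over the twisted rotations by multiples of `2π / N`. -/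
def avg (m : ℤ) (N : ℕ) : Module.End ℂ testFun :=
  (N : ℂ)⁻¹ • ∑ k ∈ Finset.range N, twist m (k * (2 * Real.pi / N))

theorem avg_eq (m : ℤ) (N : ℕ) (f : testFun) :
    avg m N f = (N : ℂ)⁻¹ • ∑ k ∈ Finset.range N, twist m (k * (2 * Real.pi / N)) f := by
  simp [avg]

theorem norm_inv_smul_sum_le {E : Type*} [NormedAddCommGroup E] [NormedSpace ℂ E] {N : ℕ}
    {v : ℕ → E} {c : ℝ} (hc : 0 ≤ c) (h : ∀ k ∈ Finset.range N, ‖v k‖ ≤ c) :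
    ‖(N : ℂ)⁻¹ • ∑ k ∈ Finset.range N, v k‖ ≤ c := by
  -- For `N = 0` the expression is `0`.
  rcases N.eq_zero_or_pos with rfl | hN
  · simpa using hc
  · have hN' : (0 : ℝ) < N := by exact_mod_cast hN
    rw [norm_smul, norm_inv, Complex.norm_natCast, inv_mul_le_iff₀ hN']
    refine (norm_sum_le_of_le _ h).trans ?_
    simp

theorem norm_toL2_avg_le (m : ℤ) (N : ℕ) (f : testFun) : ‖toL2 (avg m N f)‖ ≤ ‖toL2 f‖ := by
  rw [avg_eq, map_smul, map_sum]
  exact norm_inv_smul_sum_le (norm_nonneg _) fun k _ => (norm_toL2_twist m _ f).le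

/-- All angles in the average are at most `2π`. The bound does not improve with `N`; it serves for
functions on which `L_z - m` is already small. -/
theorem norm_toL2_avg_sub_le (m : ℤ) {N : ℕ} (hN : 0 < N) (f : testFun) :
    ‖toL2 (avg m N f) - toL2 f‖ ≤ ‖toL2 (twistGen m f)‖ * (2 * Real.pi) := by
  have hN' : (0 : ℝ) < N := by exact_mod_cast hN
  have hN0 : (N : ℂ) ≠ 0 := by exact_mod_cast hN.ne'
  have h : toL2 (avg m N f) - toL2 f = (N : ℂ)⁻¹ • ∑ k ∈ Finset.range N,
      (toL2 (twist m (k * (2 * Real.pi / N)) f) - toL2 f) := by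
    rw [Finset.sum_sub_distrib, smul_sub, Finset.sum_const, Finset.card_range,
      ← Nat.cast_smul_eq_nsmul ℂ, smul_smul, inv_mul_cancel₀ hN0, one_smul, avg_eq, map_smul,
      map_sum]
  rw [h]
  refine norm_inv_smul_sum_le (by positivity) fun k hk => ?_
  refine (norm_toL2_twist_sub_le m f _).trans ?_
  have hk' : (k : ℝ) ≤ N := by exact_mod_cast (Finset.mem_range.1 hk).le
  gcongr
  rw [abs_of_nonneg (by positivity)]
  calc (k : ℝ) * (2 * Real.pi / N) ≤ N * (2 * Real.pi / N) := by gcongr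
    _ = 2 * Real.pi := by field_simp

theorem sum_twist_sub (m : ℤ) {N : ℕ} (hN : 0 < N) (f : testFun) :
    ∑ k ∈ Finset.range N, twist m (k * (2 * Real.pi / N)) (twist m (2 * Real.pi / N) f - f) = 0 := by
  have hN' : (N : ℝ) ≠ 0 := by exact_mod_cast hN.ne'
  have h : ∀ k : ℕ, twist m (k * (2 * Real.pi / N)) (twist m (2 * Real.pi / N) f - f) =
      twist m ((k + 1 : ℕ) * (2 * Real.pi / N)) f - twist m (k * (2 * Real.pi / N)) f := by
    intro k
    rw [map_sub, ← twist_add]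
    congr 3
    push_cast
    ring
  simp only [h]
  rw [Finset.sum_range_sub (fun k : ℕ => twist m (k * (2 * Real.pi / N)) f), mul_div_cancel₀ _ hN',
    twist_two_pi, Nat.cast_zero, zero_mul, twist_zero, sub_self]

/-- The difference quotient with step `t = 2π/N` averages to zero, since the sum over the cyclic
group telescopes. It differs from the generator by `O(t)`, and averaging is a contraction. -/
theorem tendsto_avg_twistGen (m : ℤ) (f : testFun) :
    Filter.Tendsto (fun N : ℕ => ‖toL2 (avg m N (twistGen m f))‖) Filter.atTop (nhds 0) := by
  obtain ⟨K, hK0, hK⟩ := exists_norm_twist_taylor_le m f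
  have hlim : Filter.Tendsto (fun N : ℕ => K * (2 * Real.pi) / N) Filter.atTop (nhds 0) :=
    tendsto_const_div_atTop_nhds_zero_nat _
  refine squeeze_zero' (.of_forall fun _ => norm_nonneg _) ?_ hlim
  filter_upwards [Filter.eventually_gt_atTop 0] with N hN
  have hN' : (0 : ℝ) < N := by exact_mod_cast hN
  set t : ℝ := 2 * Real.pi / N with ht
  have ht0 : 0 < t := by positivity
  have h1 : (t : ℂ) • avg m N (twistGen m f) = -((N : ℂ)⁻¹ • ∑ k ∈ Finset.range N,
      twist m (k * t) (twist m t f - f - (t : ℂ) • twistGen m f)) := by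
    have h2 := sum_twist_sub m hN f
    rw [← ht] at h2
    simp only [map_sub, map_smul, Finset.sum_sub_distrib] at h2 ⊢
    rw [h2, avg_eq, ← ht, zero_sub, smul_neg, neg_neg, ← Finset.smul_sum, smul_comm]
  have h3 : t * ‖toL2 (avg m N (twistGen m f))‖ ≤ K * t ^ 2 := by
    have h4 : t * ‖toL2 (avg m N (twistGen m f))‖ = ‖toL2 ((t : ℂ) • avg m N (twistGen m f))‖ := by
      rw [map_smul, norm_smul, Complex.norm_real, Real.norm_of_nonneg ht0.le]
    rw [h4, h1, map_neg, norm_neg, map_smul, map_sum]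
    refine norm_inv_smul_sum_le (by positivity) fun k _ => ?_
    rw [norm_toL2_twist, map_sub, map_sub, map_smul]
    exact hK t
  have h5 : K * (2 * Real.pi) / N = K * t := by rw [ht]; ring
  rw [h5]
  nlinarith

theorem magnetic_avg (B : ℝ) (m : ℤ) (N : ℕ) (f : testFun) :
    magnetic B (avg m N f) = avg m N (magnetic B f) := by
  simp only [avg_eq, twist_eq, map_smul, map_sum, magnetic_rot]

theorem twistGen_avg (m : ℤ) (N : ℕ) (f : testFun) :
    twistGen m (avg m N f) = avg m N (twistGen m f) := by
  have h : angMom (avg m N f) = avg m N (angMom f) := by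
    simp only [avg_eq, twist_eq, map_smul, map_sum, angMom_rot]
  rw [twistGen_eq, twistGen_eq, h, map_smul, map_sub, map_smul]

theorem angMom_eq_twistGen (m : ℤ) (f : testFun) :
    angMom f = (m : ℂ) • f - Complex.I • twistGen m f := by
  rw [twistGen_eq, smul_smul, Complex.I_mul_I, neg_one_smul]
  abel

/-- The oscillator is `H_B + B L_z`. On an average, `L_z` acts as `m` up to an averaged generator,
and `H_B` commutes with averaging. -/
theorem oscillator_avg (B : ℝ) (m : ℤ) (N : ℕ) (f : testFun) :
    ‖toL2 (oscillator (B ^ 2 / 4) (avg m N f))‖ ≤ ‖toL2 (magnetic B f)‖ +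
      |B| * (|(m : ℝ)| * ‖toL2 f‖ + ‖toL2 (avg m N (twistGen m f))‖) := by
  have h : oscillator (B ^ 2 / 4) (avg m N f) = avg m N (magnetic B f) +
      (B : ℂ) • ((m : ℂ) • avg m N f - Complex.I • avg m N (twistGen m f)) := by
    rw [← magnetic_avg, magnetic_eq, angMom_eq_twistGen m (avg m N f), twistGen_avg]
    abel
  rw [h, map_add, map_smul, map_sub, map_smul, map_smul]
  refine (norm_add_le _ _).trans (add_le_add (norm_toL2_avg_le _ _ _) ?_)
  rw [norm_smul, Complex.norm_real, Real.norm_eq_abs]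
  refine mul_le_mul_of_nonneg_left ((norm_sub_le _ _).trans ?_) (abs_nonneg B)
  rw [norm_smul, norm_smul, Complex.norm_I, one_mul, Complex.norm_intCast]
  gcongr
  exact norm_toL2_avg_le _ _ _

/-! ### Closures -/

/-- An element of the domain of the closure is approximated in the graph norm by test functions. -/
theorem exists_seq_of_mem_closure (T : Module.End ℂ testFun) (ψ : (toPMap T).closure.domain) :
    ∃ f : ℕ → testFun,
      Filter.Tendsto (fun n => toL2 (f n)) Filter.atTop (nhds (ψ : L2Space)) ∧
      Filter.Tendsto (fun n => toL2 (T (f n))) Filter.atTop (nhds ((toPMap T).closure ψ)) := by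
  have hgraph : ∀ p ∈ (toPMap T).graph, ∃ f : testFun, p = (toL2 f, toL2 (T f)) := by
    rintro ⟨a, b⟩ hp
    obtain ⟨⟨y, f, rfl⟩, h1, h2⟩ := (LinearPMap.mem_graph_iff _).1 hp
    refine ⟨f, Prod.ext h1.symm (h2.symm.trans ?_)⟩
    change toL2 (T ((LinearEquiv.ofInjective toL2 toL2_injective).symm ⟨toL2 f, _⟩)) = _
    congr 2
    exact (LinearEquiv.symm_apply_eq _).2 (Subtype.ext rfl)
  have hmem : ((ψ : L2Space), (toPMap T).closure ψ) ∈
      closure ((toPMap T).graph : Set (L2Space × L2Space)) := by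
    have h := (toPMap T).closure.mem_graph ψ
    by_cases hc : (toPMap T).IsClosable
    · rwa [← hc.graph_closure_eq_closure_graph] at h
    -- Without closability, `closure` is by default the operator itself, so closability need not be
    -- proved.
    · refine subset_closure ?_
      have e : (toPMap T).closure.graph = (toPMap T).graph := by
        rw [LinearPMap.closure_def' hc]
      exact e ▸ h
  obtain ⟨p, hp, hlim⟩ := mem_closure_iff_seq_limit.1 hmem
  choose f hf using fun n => hgraph (p n) (hp n)
  have hpf : p = fun n => (toL2 (f n), toL2 (T (f n))) := funext hf
  rw [hpf] at hlim
  exact ⟨f, (Prod.tendsto_iff _ _).1 hlim⟩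

/-- Averaging does not increase the distance to an element of the sector. -/
theorem norm_toL2_avg_sub_le_of_mem_sector {m : ℤ} {ψ : L2Space} (hψ : ψ ∈ angularSector m)
    {N : ℕ} (hN : 0 < N) (f : testFun) : ‖toL2 (avg m N f) - ψ‖ ≤ ‖toL2 f - ψ‖ := by
  obtain ⟨hd, he⟩ := hψ
  obtain ⟨g, hg, hLg⟩ := exists_seq_of_mem_closure angMom ⟨ψ, hd⟩
  change Filter.Tendsto _ _ (nhds (angularMomentum ⟨ψ, hd⟩)) at hLg
  rw [he] at hLg
  change Filter.Tendsto _ _ (nhds ψ) at hg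
  have hD : Filter.Tendsto (fun n => ‖toL2 (twistGen m (g n))‖) Filter.atTop (nhds 0) := by
    have h := ((hLg.sub (hg.const_smul (m : ℂ))).const_smul Complex.I).norm
    rw [sub_self, smul_zero, norm_zero] at h
    refine h.congr fun n => ?_
    rw [twistGen_eq, map_smul, map_sub, map_smul]
  -- The `g n` approximate `ψ` in the graph norm of `L_z`, so they are nearly invariant under
  -- averaging and can stand in for `ψ`.
  have hbound : ∀ n, ‖toL2 (avg m N f) - ψ‖ ≤ ‖toL2 f - toL2 (g n)‖ +
      ‖toL2 (twistGen m (g n))‖ * (2 * Real.pi) + ‖toL2 (g n) - ψ‖ := by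
    intro n
    have e : toL2 (avg m N f) - ψ = toL2 (avg m N (f - g n)) +
        (toL2 (avg m N (g n)) - toL2 (g n)) + (toL2 (g n) - ψ) := by
      rw [map_sub, map_sub]; abel
    rw [e, ← map_sub]
    exact (norm_add₃_le).trans (add_le_add (add_le_add (norm_toL2_avg_le _ _ _)
      (norm_toL2_avg_sub_le m hN _)) le_rfl)
  have hlim : Filter.Tendsto (fun n => ‖toL2 f - toL2 (g n)‖ +
      ‖toL2 (twistGen m (g n))‖ * (2 * Real.pi) + ‖toL2 (g n) - ψ‖) Filter.atTop
      (nhds (‖toL2 f - ψ‖ + 0 * (2 * Real.pi) + ‖ψ - ψ‖)) :=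
    ((hg.const_sub _).norm.add (hD.mul_const _)).add (hg.sub_const _).norm
  rw [zero_mul, add_zero, sub_self, norm_zero, add_zero] at hlim
  exact ge_of_tendsto' hlim hbound

/-- Elements of the sector in the domain of the magnetic Hamiltonian are limits of test functions
on which the oscillator is controlled. -/
theorem exists_seq_of_mem_sector (B : ℝ) {m : ℤ} (ψ : (magneticHamiltonian B).domain)
    (hψ : (ψ : L2Space) ∈ angularSector m) : ∃ (g : ℕ → testFun) (a : ℕ → ℝ),
      Filter.Tendsto (fun n => toL2 (g n)) Filter.atTop (nhds (ψ : L2Space)) ∧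
      (∀ n, ‖toL2 (oscillator (B ^ 2 / 4) (g n))‖ ≤ a n) ∧
      Filter.Tendsto a Filter.atTop
        (nhds (‖magneticHamiltonian B ψ‖ + |B| * (|(m : ℝ)| * ‖(ψ : L2Space)‖))) := by
  obtain ⟨f, hf, hHf⟩ := exists_seq_of_mem_closure (magnetic B) ψ
  -- The rate in `N` depends on the function, so `N` is chosen separately for each `f n`.
  have hN : ∀ n : ℕ, ∃ N : ℕ, 0 < N ∧ ‖toL2 (avg m N (twistGen m (f n)))‖ < 1 / ((n : ℝ) + 1) :=
    fun n => ((Filter.eventually_gt_atTop 0).and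
      ((tendsto_avg_twistGen m (f n)).eventually_lt_const (by positivity))).exists
  choose N hN0 hN1 using hN
  refine ⟨fun n => avg m (N n) (f n), fun n => ‖toL2 (magnetic B (f n))‖ +
    |B| * (|(m : ℝ)| * ‖toL2 (f n)‖ + 1 / ((n : ℝ) + 1)), ?_, fun n => ?_, ?_⟩
  · rw [tendsto_iff_norm_sub_tendsto_zero] at hf ⊢
    exact squeeze_zero (fun _ => norm_nonneg _)
      (fun n => norm_toL2_avg_sub_le_of_mem_sector hψ (hN0 n) (f n)) hf
  · refine (oscillator_avg B m (N n) (f n)).trans ?_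
    exact add_le_add_right (mul_le_mul_of_nonneg_left (add_le_add_right (hN1 n).le _)
      (abs_nonneg B)) _
  · have h := hHf.norm.add (((hf.norm.const_mul |(m : ℝ)|).add
      tendsto_one_div_add_atTop_nhds_zero_nat).const_mul |B|)
    rwa [add_zero] at h

end testFun

/-! ### Passage to the sector, and the conclusion. -/

/-- A bound on test functions by the oscillator passes to the sector. -/
theorem eLpNorm_mul_le_of_mem_sector {B : ℝ} {m : ℤ} {V : Space3 → ℝ}
    (hV : AEStronglyMeasurable V volume) {b₁ b₂ : ℝ} (hb₁ : 0 ≤ b₁)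
    (hbound : ∀ f : testFun, eLpNorm (fun x => (V x : ℂ) * (f : Space3 → ℂ) x) 2 volume ≤
      ENNReal.ofReal (b₁ * ‖testFun.toL2 (testFun.oscillator (B ^ 2 / 4) f)‖ +
        b₂ * ‖testFun.toL2 f‖))
    (ψ : (magneticHamiltonian B).domain) (hψ : (ψ : L2Space) ∈ angularSector m) :
    eLpNorm (fun x => (V x : ℂ) * (ψ : L2Space) x) 2 volume ≤
      ENNReal.ofReal (b₁ * ‖magneticHamiltonian B ψ‖ +
        (b₁ * (|B| * |(m : ℝ)|) + b₂) * ‖(ψ : L2Space)‖) := by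
  obtain ⟨g, a, hg, hga, ha⟩ := testFun.exists_seq_of_mem_sector B ψ hψ
  -- Along an almost everywhere convergent subsequence, Fatou's lemma bounds the norm of `V ψ`
  -- without first knowing that `V ψ` is in `L²`.
  obtain ⟨ns, hns, hae⟩ := (tendstoInMeasure_of_tendsto_Lp hg).exists_seq_tendsto_ae
  have hae' : ∀ᵐ x : Space3, ∀ n, (testFun.toL2 (g n) : Space3 → ℂ) x = (g n : Space3 → ℂ) x :=
    ae_all_iff.2 fun n => testFun.coeFn_toL2 (g n)
  have hmeas : ∀ n, AEStronglyMeasurable (fun x => (V x : ℂ) * (g (ns n) : Space3 → ℂ) x) volume :=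
    fun n => (Complex.continuous_ofReal.comp_aestronglyMeasurable hV).mul
      (testFun.contDiff (g (ns n))).continuous.aestronglyMeasurable
  refine (Lp.eLpNorm_lim_le_liminf_eLpNorm hmeas _ ?_).trans ?_
  · filter_upwards [hae, hae'] with x hx hx'
    simp only [hx'] at hx
    exact hx.const_mul _
  · have hlim := ENNReal.tendsto_ofReal (((ha.comp hns.tendsto_atTop).const_mul b₁).add
      ((hg.comp hns.tendsto_atTop).norm.const_mul b₂))
    refine (Filter.liminf_le_liminf (.of_forall fun n => ?_)).trans (hlim.liminf_eq.trans_le ?_)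
    · refine (hbound (g (ns n))).trans (ENNReal.ofReal_le_ofReal ?_)
      exact add_le_add_left (mul_le_mul_of_nonneg_left (hga _) hb₁) _
    · exact ENNReal.ofReal_le_ofReal (le_of_eq (by ring))

end

theorem mainTheorem7 (B : ℝ) (hB : 0 < B) (V : Space3 → ℝ)
    (hloc : ∀ K : Set Space3, IsCompact K → MemLp V 2 (volume.restrict K))
    (R : ℝ) (hR : 0 < R) (M : ℝ)
    (hslab : ∀ n : ℤ,
      ∫⁻ x in {x : Space3 | (n : ℝ) ≤ x 2 ∧ x 2 ≤ (n : ℝ) + 1 ∧ rPerp x < R}, ‖V x‖ₑ ^ 2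
        ≤ ENNReal.ofReal (M ^ 2))
    (C C_V : ℝ) (hCV : C_V < B ^ 2 / 4)
    (hgrowth : ∀ᵐ x : Space3, R < rPerp x → |V x| ≤ C + C_V * rPerp x ^ 2) :
    ∀ m : ℤ, ∃ b₁ b₂ : ℝ, 0 ≤ b₁ ∧ b₁ < 1 ∧ 0 ≤ b₂ ∧
      RelBoundedOn (angularSector m) (magneticHamiltonian B) (mulOp V) b₁ b₂ := by
  intro m
  have hV := aestronglyMeasurable_of_memLp_compact hloc
  obtain ⟨b₁, b₂, hb₁, hb₁', hb₂, hbound⟩ := testFun.exists_oscillator_bound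
    (w := B ^ 2 / 4) (by positivity) hV hR hslab hCV hgrowth
  -- The shift `B m` between `H_B` and the oscillator enters only the second constant; `b₁` does not
  -- depend on `m`.
  refine ⟨b₁, b₁ * (|B| * |(m : ℝ)|) + b₂, hb₁, hb₁', by positivity, fun ψ hψ => ?_⟩
  have h := eLpNorm_mul_le_of_mem_sector (m := m) hV hb₁ hbound ψ hψ
  have hmem : MemLp (fun x => (V x : ℂ) * (ψ : L2Space) x) 2 volume :=
    ⟨(Complex.continuous_ofReal.comp_aestronglyMeasurable hV).mul (Lp.aestronglyMeasurable _),
      h.trans_lt ENNReal.ofReal_lt_top⟩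
  refine ⟨hmem, ?_⟩
  change ‖hmem.toLp _‖ ≤ _
  rw [Lp.norm_toLp]
  exact ENNReal.toReal_le_of_le_ofReal (by positivity) h
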